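/- Let $q$ be a prime power, $h\ge 2$, and let $1\le u_0<u_1\le\dots\le u_h$ and $k$ be integers with $h\le q$, $k\ge\sum_{i=1}^h u_i-(h-1)u_0$, $q^k-q^{k-1}>q^{u_0}-1+\sum_{i=1}^h(q^{u_i}-q^{u_0})$ and $u_1>(h-1)\frac{q^{u_0}-1}{q-1}$. Let $U_0,U_1,\dots,U_h$ be subspaces of $\mathbf F_q^k$ with $\dim U_i=u_i$ for $0\le i\le h$ and $U_i\cap U_j=U_0$ for $1\le i<j\le h$. Choose one vector from each set $\{\lambda v:\lambda\in\mathbf F_q^*\}$, where $v$ runs through the vectors of $\mathbf F_q^k\setminus\bigcup_{i=1}^hU_i$, and let $\mathbf C_3$ be the code generated by the rows of the matrix $\widetilde G$ that has the chosen vectors as its columns. Then $\mathbf C_3$ is a linear $[n,k,d]_q$ code with $$n=\frac{q^k-q^{u_0}-\sum_{i=1}^h(q^{u_i}-q^{u_0})}{q-1},\qquad d=q^{k-1}-\sum_{i=1}^hq^{u_i-1},$$ and it is optimal: there is no linear $[n,k,d+1]_q$ code. Moreover, the following holds. (a) Suppose that $\dim(U_1+\dots+U_h)=\sum_{i=1}^hu_i-(h-1)u_0$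 (this is automatic for $h=2$, and such subspaces exist for all parameters as above). Put $e=k+(h-1)u_0-\sum_{i=1}^hu_i$. The weight distribution of $\mathbf C_3$ is: weight $0$ with multiplicity $1$; weight $q^{k-1}+(h-1)q^{u_0-1}-\sum_{i=1}^hq^{u_i-1}$ with multiplicity $(q^{u_0}-1)q^{k-u_0}$; for every nonempty $S\subseteq\{1,\dots,h\}$, weight $q^{k-1}-\sum_{i\in S}q^{u_i-1}$ with multiplicity $q^{e}\prod_{i\in S}(q^{u_i-u_0}-1)$; and weight $q^{k-1}$ with multiplicity $q^{e}-1$. Multiplicities of equal weights are added. (b) Let $h=2$. The $r$-th generalized Hamming weight, that is, the minimum of $|\mathrm{supp}(D)|$ over the $r$-dimensional subcodes $D$ of $\mathbf C_3$, where $\mathrm{supp}(D)$ is the set of positions at which some word of $D$ is nonzero, is $$d_r(\mathbf C_3)=\begin{cases}\dfrac{q^k-q^{k-r}-(q^{u_1}-q^{u_1-r})-(q^{u_2}-q^{u_2-r})}{q-1},&1\le r\le u_1-u_0,\\[2mm]\dfrac{q^k-q^{k-r}-q^{u_1}-(q^{u_2}-q^{u_2-r})+q^{u_0}}{q-1},&u_1-u_0\le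 r\le u_2,\\[2mm]\dfrac{q^k-q^{k-r}-q^{u_1}-q^{u_2}+q^{u_0}+1}{q-1},&u_2\le r<k.\end{cases}$$ (c) Let $h=2$. For $1\le r\le k$ and $j\ge0$, the number of $r$-dimensional subcodes $D$ of $\mathbf C_3$ with $|\mathrm{supp}(D)|=j$ is $$A_j^r(\mathbf C_3)=\sum_{(v_0,v_1,v_2)}N^{k,u_0,u_1,u_2}_{k-r,v_0,v_1,v_2},$$ where the sum is over all $(v_0,v_1,v_2)\in\mathbf Z^3$ with $$\frac{q^{v_1}-1}{q-1}+\frac{q^{v_2}-1}{q-1}-\frac{q^{v_0}-1}{q-1}=j-\frac{q^k-q^{u_1}-q^{u_2}+q^{u_0}-q^{k-r}+1}{q-1},$$ $\max\{u_i-r,0\}\le v_i\le\min\{k-r,u_i\}$ for $i=0,1,2$, $v_0\le v_1$, $v_0\le v_2$, $v_1-v_0\le u_1-u_0$, $v_2-v_0\le u_2-u_0$ and $v_1+v_2-v_0\le k-r$. Here, for integers $l,v_0,v_1,v_2\ge0$ with $v_0\le v_1$ and $v_0\le v_2$, $N^{k,u_0,u_1,u_2}_{l,v_0,v_1,v_2}$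 is the number of $l$-dimensional subspaces $V$ of $\mathbf F_q^k$ with $\dim(V\cap U_i)=v_i$ for $i=0,1,2$, and this number is zero unless $v_0\le u_0$, $v_1-v_0\le u_1-u_0$ and $v_2-v_0\le u_2-u_0$, in which case it equals $$\sum_{t=0}^{\min\{u_1-v_1,u_2-v_2\}}q^{(u_1+u_2-u_0-s_t)(l-s_t)}\,G(k-u_1-u_2+u_0,\,l-s_t)\,N_t,\qquad s_t=t+v_1+v_2-v_0,$$ $$N_t=G(u_0,v_0)\,q^{(u_0-v_0)(t+v_1+v_2-2v_0)}\Big(\prod_{i=0}^{t-1}(q^t-q^i)\Big)G(u_1-u_0-v_1+v_0,t)\,G(u_2-u_0-v_2+v_0,t)\,G(u_1-u_0,v_1-v_0)\,G(u_2-u_0,v_2-v_0),$$ where $G(m,r)=\prod_{i=0}^{r-1}\frac{q^m-q^i}{q^r-q^i}$ is the $q$-ary Gaussian binomial coefficient, which is $0$ for $r>m$ and for $r<0$ (a term containing a zero coefficient is zero). -/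

import Mathlib

open Module

/-! ### Linear codes: a code of length `n` over `F` is a subspace of `F^n` -/

/-- The linear code generated by the rows of `G`, that is, `{a G : a ∈ F^k}`. -/
def rowCode {F : Type*} [Field F] {k n : ℕ} (G : Matrix (Fin k) (Fin n) F) :
    Submodule F (Fin n → F) :=
  LinearMap.range G.vecMulLinear

/-- `C` is an `[n, k, d]` linear code: it has dimension `k`, and `d` is the minimum of the Hamming
distances between distinct codewords. -/
def IsLinearCode {F : Type*} [Field F] [DecidableEq F] {n : ℕ} (C : Submodule F (Fin n → F))
    (k d : ℕ) : Prop :=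
  finrank F C = k ∧ IsLeast {w : ℕ | ∃ a ∈ C, ∃ b ∈ C, a ≠ b ∧ hammingDist a b = w} d

/-- An `[n, k, d]` code is optimal if it is an `[n, k, d]` linear code and there is no
`[n, k, d + 1]` linear code over the same field. -/
def IsOptimalCode {F : Type*} [Field F] [DecidableEq F] {n : ℕ} (C : Submodule F (Fin n → F))
    (k d : ℕ) : Prop :=
  IsLinearCode C k d ∧ ¬ ∃ C' : Submodule F (Fin n → F), IsLinearCode C' k (d + 1)

/-- `A_w(C)`: the number of codewords of Hamming weight `w`. -/
noncomputable def weightCount {F : Type*} [Field F] [DecidableEq F] {n : ℕ}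
    (C : Submodule F (Fin n → F)) (w : ℕ) : ℕ :=
  {c : Fin n → F | c ∈ C ∧ hammingNorm c = w}.ncard

/-- The support weight of a subcode `D`: the number of positions at which some word of `D`
does not vanish. -/
noncomputable def supportWeight {F : Type*} [Field F] {n : ℕ} (D : Submodule F (Fin n → F)) : ℕ :=
  {i : Fin n | ∃ c ∈ D, c i ≠ 0}.ncard

/-- The `r`-th generalized Hamming weight `d_r(C)`, meaningful for `r ≤ dim C`. -/
noncomputable def genHammingWeight {F : Type*} [Field F] {n : ℕ} (C : Submodule F (Fin n → F))
    (r : ℕ) : ℕ :=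
  sInf {w : ℕ | ∃ D : Submodule F (Fin n → F), D ≤ C ∧ finrank F D = r ∧ supportWeight D = w}

/-- `A_j^r(C)`: the number of `r`-dimensional subcodes of support weight `j`. -/
noncomputable def subcodeCount {F : Type*} [Field F] {n : ℕ} (C : Submodule F (Fin n → F))
    (r j : ℕ) : ℕ :=
  {D : Submodule F (Fin n → F) | D ≤ C ∧ finrank F D = r ∧ supportWeight D = j}.ncard

/-! ### The construction -/

/-- The subspaces `U i` of `F^k` have dimensions `u i` and intersect pairwise in the
`u₀`-dimensional subspace `U₀`. -/
def IsSunflower {F : Type*} [Field F] {k h : ℕ} (u₀ : ℕ) (u : Fin h → ℕ)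
    (U₀ : Submodule F (Fin k → F)) (U : Fin h → Submodule F (Fin k → F)) : Prop :=
  finrank F U₀ = u₀ ∧ (∀ i, finrank F (U i) = u i) ∧ ∀ i j, i ≠ j → U i ⊓ U j = U₀

/-- The columns of `G` are the points of the projective space of `F^k` that lie outside every
`U i`, each represented by exactly one (arbitrarily chosen) nonzero vector. -/
def IsComplementMatrix {F : Type*} [Field F] {k n h : ℕ}
    (U : Fin h → Submodule F (Fin k → F)) (G : Matrix (Fin k) (Fin n) F) : Prop :=
  (∀ j, G.col j ≠ 0 ∧ ∀ i, G.col j ∉ U i) ∧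
    ∀ v : Fin k → F, v ≠ 0 → (∀ i, v ∉ U i) → ∃! j, ∃ c : F, c ≠ 0 ∧ v = c • G.col j

/-! ### Subspace counts -/

/-- The `q`-ary Gaussian binomial coefficient
`(q^m - 1)(q^m - q) ⋯ (q^m - q^(r-1)) / ((q^r - 1)(q^r - q) ⋯ (q^r - q^(r-1)))`;
it is zero for `r > m`. -/
def gaussian (q m r : ℕ) : ℚ :=
  (∏ i ∈ Finset.range r, ((q : ℚ) ^ m - (q : ℚ) ^ i)) /
    ∏ i ∈ Finset.range r, ((q : ℚ) ^ r - (q : ℚ) ^ i)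

/-- `N_t(u₁, u₂, v₁, v₂)`: for `U₁ ∩ U₂ = 0`, the number of `(t + v₁ + v₂)`-dimensional subspaces
of `U₁ ⊕ U₂` that meet `U₁`, `U₂` in dimensions `v₁`, `v₂`. -/
def countDirect (q t u₁ u₂ v₁ v₂ : ℕ) : ℚ :=
  (∏ i ∈ Finset.range t, ((q : ℚ) ^ t - (q : ℚ) ^ i)) *
    gaussian q (u₁ - v₁) t * gaussian q (u₂ - v₂) t * gaussian q u₁ v₁ * gaussian q u₂ v₂

/-- `N_t(u₀, u₁, u₂, v₀, v₁, v₂)`: for `U₁ ∩ U₂ = U₀`, the number of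
`(t + v₁ + v₂ - v₀)`-dimensional subspaces of `U₁ + U₂` that meet `U₀`, `U₁`, `U₂` in dimensions
`v₀`, `v₁`, `v₂` (used for `v₀ ≤ v₁, v₂`). -/
def countSum (q t u₀ u₁ u₂ v₀ v₁ v₂ : ℕ) : ℚ :=
  gaussian q u₀ v₀ * (q : ℚ) ^ ((u₀ - v₀) * (t + (v₁ - v₀) + (v₂ - v₀))) *
    countDirect q t (u₁ - u₀) (u₂ - u₀) (v₁ - v₀) (v₂ - v₀)

/-- `N^{k,u₀,u₁,u₂}_{l,v₀,v₁,v₂}`, the sum over `0 ≤ t ≤ min (u₁ - v₁) (u₂ - v₂)` of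
`q^((u₁+u₂-u₀ - s)(l - s)) * Gaussian(k-u₁-u₂+u₀, l-s) * N_t(u₀,u₁,u₂,v₀,v₁,v₂)`, where
`s = t+v₁+v₂-v₀`; a term with `s > l` is zero, because its Gaussian coefficient is. -/
def countSubspaces (q k u₀ u₁ u₂ l v₀ v₁ v₂ : ℕ) : ℚ :=
  ∑ t ∈ Finset.range (min (u₁ - v₁) (u₂ - v₂) + 1),
    if t + v₁ + v₂ ≤ l + v₀ then
      (q : ℚ) ^ ((u₁ + u₂ + v₀ - (u₀ + v₁ + v₂ + t)) * (l + v₀ - (t + v₁ + v₂))) *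
        gaussian q (k + u₀ - (u₁ + u₂)) (l + v₀ - (t + v₁ + v₂)) *
        countSum q t u₀ u₁ u₂ v₀ v₁ v₂
    else 0

/-- The set of triples `(v₀, v₁, v₂)` that index the subcode support weight distribution. The lower
bounds `u - r` are truncated subtractions, that is, `max (u - r) 0`. -/
def sswdSet (q k u₀ u₁ u₂ r j : ℕ) : Finset (ℕ × ℕ × ℕ) :=
  (Finset.Icc (u₀ - r) (min (k - r) u₀) ×ˢ Finset.Icc (u₁ - r) (min (k - r) u₁) ×ˢ
      Finset.Icc (u₂ - r) (min (k - r) u₂)).filter fun v =>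
    ((q : ℚ) ^ v.2.1 - 1) / (q - 1) + ((q : ℚ) ^ v.2.2 - 1) / (q - 1)
          - ((q : ℚ) ^ v.1 - 1) / (q - 1)
        = j - ((q : ℚ) ^ k - q ^ u₁ - q ^ u₂ + q ^ u₀ - q ^ (k - r) + 1) / (q - 1) ∧
      v.1 ≤ v.2.1 ∧ v.1 ≤ v.2.2 ∧
      v.2.1 + u₀ ≤ u₁ + v.1 ∧ v.2.2 + u₀ ≤ u₂ + v.1 ∧
      v.2.1 + v.2.2 ≤ k - r + v.1

/-! ### Counting by fibres -/

/-! Everything rests on one count. A column vanishes on all words `a G`, `a ∈ A`, exactly when it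
lies in the orthogonal `V` of `A`, so `q - 1` times the support weight of the subcode is the number
of vectors outside all petals minus the number of such vectors in `V`. For a sunflower,
inclusion-exclusion collapses and the latter depends only on the dimensions of `V`, `V ⊓ U₀` and `V
⊓ U i` (`IsSunflower.supportWeight_eq`).

For a single word `V` is a hyperplane `a^⊥`, and the weight depends only on whether `a` is
orthogonal to `U₀` and, if so, on the set of petals to which it is not orthogonal. The minimum is
reached when `a` kills `U₀` but no petal; such `a` exists because at most `q` proper subspaces
cannot cover a space. The size hypothesis makes the minimum positive, so the dimension is `k`.
Optimality comes from the Griesmer bound: asking for distance `d + 1` raises its estimate by at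
least the smallest petal dimension, whereas the length exceeds the estimate for `d` by only `(h -
1)(q^u₀ - 1)/(q - 1)` (`le_mul_sum_ceilDiv`). In (a), the hypothesis on the sum makes the
orthogonals of the petals independent inside that of `U₀`, so all patterns occur with product
multiplicities (`ncard_forall_mem_iff_notMem`).

For two petals, `r`-dimensional subcodes correspond to subspaces `V` of dimension `k - r`, and the
support weight is governed by `q^v₁ + q^v₂ - q^v₀` with `vᵢ = dim (V ⊓ Uᵢ)`. Counting the `V` with
given `vᵢ` is done by successive fibrations: `V ↦ V ⊓ (U₁ ⊔ U₂)`, then `W ↦ (W ⊓ U₀, W ⊔ U₀)`, then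
`Y ↦ (Y ⊓ U₁, Y ⊓ U₂)`, each with constant fibres counted by tuples independent modulo a subspace.
This gives (c). In (b) the lower bounds are dimension estimates, and a minimizing `V` exists because
its count is positive. -/

theorem ncard_eq_sum_ncard_fiber {α ι : Type*} [Finite α] [DecidableEq ι] {S : Set α}
    (I : Finset ι) (f : α → ι) (hf : ∀ a ∈ S, f a ∈ I) :
    S.ncard = ∑ i ∈ I, {a ∈ S | f a = i}.ncard := by
  classical
  have := Fintype.ofFinite α
  rw [Set.ncard_eq_toFinset_card', Finset.card_eq_sum_card_fiberwise (f := f) (t := I)]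
  · refine Finset.sum_congr rfl fun i _ => ?_
    rw [Set.ncard_eq_toFinset_card']
    congr 1
    ext a
    simp
  · intro a ha
    exact hf a (by simpa using ha)

theorem ncard_eq_mul_of_fiber {α β : Type*} [Finite α] [Finite β] {S : Set α} {T : Set β}
    (f : α → β) (c : ℕ) (hf : ∀ a ∈ S, f a ∈ T) (hc : ∀ b ∈ T, {a ∈ S | f a = b}.ncard = c) :
    S.ncard = T.ncard * c := by
  classical
  have := Fintype.ofFinite β
  rw [ncard_eq_sum_ncard_fiber T.toFinset f (fun a ha => by simpa using hf a ha),
    Finset.sum_congr rfl (fun b hb => hc b (by simpa using hb)), Finset.sum_const,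
    Set.ncard_eq_toFinset_card', smul_eq_mul]

/-! ### Tuples that are independent modulo a subspace -/

section Counting

variable {F E : Type*} [Field F] [AddCommGroup E] [Module F E]

theorem linearIndependent_mkQ_iff {m : ℕ} (A : Submodule F E) (s : Fin m → E) :
    LinearIndependent F (A.mkQ ∘ s) ↔ ∀ c : Fin m → F, ∑ i, c i • s i ∈ A → c = 0 := by
  rw [Fintype.linearIndependent_iff]
  refine forall_congr' fun c => ?_
  have : ∑ i, c i • (A.mkQ ∘ s) i = A.mkQ (∑ i, c i • s i) := by simp [map_sum]
  rw [this, Submodule.mkQ_apply, Submodule.Quotient.mk_eq_zero, funext_iff]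
  rfl

/-- The `m`-tuples in `B` that are linearly independent modulo `A`. -/
def indepTuples (A B : Submodule F E) (m : ℕ) : Set (Fin m → E) :=
  {s | (∀ i, s i ∈ B) ∧ LinearIndependent F (A.mkQ ∘ s)}

theorem span_range_le {m : ℕ} {B : Submodule F E} {s : Fin m → E} (hs : ∀ i, s i ∈ B) :
    Submodule.span F (Set.range s) ≤ B :=
  Submodule.span_le.2 (Set.range_subset_iff.2 hs)

variable [Finite E]

theorem finrank_sup_span_range {m : ℕ} {A : Submodule F E} {s : Fin m → E}
    (hs : LinearIndependent F (A.mkQ ∘ s)) :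
    finrank F ↥(A ⊔ Submodule.span F (Set.range s)) = finrank F A + m := by
  have hd := Submodule.range_ker_disjoint hs
  rw [Submodule.ker_mkQ] at hd
  have h := Submodule.finrank_sup_add_finrank_inf_eq A (Submodule.span F (Set.range s))
  rw [hd.symm.eq_bot, finrank_bot, add_zero,
    finrank_span_eq_card (LinearIndependent.of_comp _ hs), Fintype.card_fin] at h
  exact h

variable [Fintype F]

theorem ncard_submodule (A : Submodule F E) :
    (A : Set E).ncard = Fintype.card F ^ finrank F A := by
  rw [← Nat.card_coe_set_eq, ← Nat.card_eq_fintype_card]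
  exact Module.natCard_eq_pow_finrank (K := F) (V := A)

theorem ncard_diff_submodule {A B : Submodule F E} (h : A ≤ B) :
    ((B : Set E) \ A).ncard = Fintype.card F ^ finrank F B - Fintype.card F ^ finrank F A := by
  rw [Set.ncard_sdiff (by exact h), ncard_submodule, ncard_submodule]

theorem ncard_tuples (A : Submodule F E) (m : ℕ) :
    {s : Fin m → E | ∀ i, s i ∈ A}.ncard = Fintype.card F ^ (finrank F A * m) := by
  have e : {s : Fin m → E | ∀ i, s i ∈ A} ≃ (Fin m → A) :=
    { toFun := fun s i => ⟨s.1 i, s.2 i⟩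
      invFun := fun s => ⟨fun i => s i, fun i => (s i).2⟩
      left_inv := fun _ => rfl
      right_inv := fun _ => rfl }
  rw [← Nat.card_coe_set_eq, Nat.card_congr e, Nat.card_fun, Nat.card_fin, pow_mul,
    Module.natCard_eq_pow_finrank (K := F) (V := A), Nat.card_eq_fintype_card]

/-- A tuple independent modulo `A` extends by precisely the vectors of `B` outside the span of `A`
and the tuple, a space of dimension `finrank F A + m`. -/
theorem ncard_indepTuples {A B : Submodule F E} (h : A ≤ B) (m : ℕ) :
    (indepTuples A B m).ncard =
      ∏ i ∈ Finset.range m,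
        (Fintype.card F ^ finrank F B - Fintype.card F ^ (finrank F A + i)) := by
  induction m with
  | zero =>
    have : indepTuples A B 0 = {fun i => i.elim0} := by
      ext s
      simp only [indepTuples, Set.mem_ofPred_eq, Set.mem_singleton_iff]
      exact ⟨fun _ => Subsingleton.elim _ _,
        fun _ => ⟨fun i => i.elim0, linearIndependent_empty_type⟩⟩
    simp [this]
  | succ m ih =>
    rw [Finset.prod_range_succ, ← ih]
    have key : ∀ (s : Fin m → E) (x : E), Fin.snoc s x ∈ indepTuples A B (m + 1) ↔
        s ∈ indepTuples A B m ∧ x ∈ (B : Set E) \ ↑(A ⊔ Submodule.span F (Set.range s)) := by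
      intro s x
      have h1 : A.mkQ ∘ (Fin.snoc s x : Fin (m + 1) → E) = Fin.snoc (A.mkQ ∘ s) (A.mkQ x) := by
        ext i
        refine Fin.lastCases ?_ (fun i => ?_) i <;> simp
      have h2 : A.mkQ x ∈ Submodule.span F (Set.range (A.mkQ ∘ s)) ↔
          x ∈ A ⊔ Submodule.span F (Set.range s) := by
        rw [Set.range_comp, Submodule.span_image, ← Submodule.mem_comap,
          Submodule.comap_map_mkQ]
      simp only [indepTuples, Set.mem_ofPred_eq, Fin.forall_fin_succ', Fin.snoc_castSucc,
        Fin.snoc_last, h1, linearIndependent_finSnoc, h2, Set.mem_sdiff, SetLike.mem_coe]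
      tauto
    refine ncard_eq_mul_of_fiber (fun s => Fin.init s) _ (fun s hs => ?_) (fun s hs => ?_)
    · rw [← Fin.snoc_init_self s] at hs
      exact ((key _ _).1 hs).1
    · have himg : {a ∈ indepTuples A B (m + 1) | Fin.init a = s} =
          (fun x => (Fin.snoc s x : Fin (m + 1) → E)) ''
            ((B : Set E) \ ↑(A ⊔ Submodule.span F (Set.range s))) := by
        ext a
        constructor
        · rintro ⟨ha, rfl⟩
          rw [← Fin.snoc_init_self a] at ha
          exact ⟨_, ((key _ _).1 ha).2, Fin.snoc_init_self a⟩
        · rintro ⟨x, hx, rfl⟩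
          exact ⟨(key _ _).2 ⟨hs, hx⟩, Fin.init_snoc _ _⟩
      rw [himg, Set.ncard_image_of_injective _ (fun x y hxy => by
        have := congrFun hxy (Fin.last m)
        simpa using this), ncard_diff_submodule (sup_le h (span_range_le hs.1)),
        finrank_sup_span_range hs.2]

end Counting

/-! ### Gaussian binomial coefficients -/

/-- Truncated subtraction does no harm: if some factor on the left would be negative, then the
factor `i = b - a` is present and both products vanish. -/
theorem cast_prod_pow_sub_pow {q a b : ℕ} (hq : 1 ≤ q) (hab : a ≤ b) (m : ℕ) :
    ((∏ i ∈ Finset.range m, (q ^ b - q ^ (a + i)) : ℕ) : ℚ) =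
      (q : ℚ) ^ (a * m) * ∏ i ∈ Finset.range m, ((q : ℚ) ^ (b - a) - (q : ℚ) ^ i) := by
  by_cases hm : m ≤ b - a
  · have : (q : ℚ) ^ (a * m) = ∏ _i ∈ Finset.range m, (q : ℚ) ^ a := by
      rw [Finset.prod_const, Finset.card_range, pow_mul]
    rw [this, ← Finset.prod_mul_distrib, Nat.cast_prod]
    refine Finset.prod_congr rfl fun i hi => ?_
    rw [Finset.mem_range] at hi
    rw [Nat.cast_sub (Nat.pow_le_pow_right hq (by omega)), mul_sub, ← pow_add, ← pow_add,
      Nat.add_sub_cancel' hab]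
    push_cast
    rfl
  · have hmem : b - a ∈ Finset.range m := Finset.mem_range.2 (by omega)
    rw [Finset.prod_eq_zero hmem (by rw [Nat.add_sub_cancel' hab, Nat.sub_self]),
      Finset.prod_eq_zero hmem (sub_self _)]
    simp

theorem prod_pow_sub_pow_pos {q m r : ℕ} (hq : 2 ≤ q) (hr : r ≤ m) :
    0 < ∏ i ∈ Finset.range r, ((q : ℚ) ^ m - (q : ℚ) ^ i) := by
  refine Finset.prod_pos fun i hi => sub_pos.2 ?_
  rw [Finset.mem_range] at hi
  exact pow_lt_pow_right₀ (by exact_mod_cast hq) (by omega)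

theorem gaussian_pos {q m r : ℕ} (hq : 2 ≤ q) (hr : r ≤ m) : 0 < gaussian q m r :=
  div_pos (prod_pow_sub_pow_pos hq hr) (prod_pow_sub_pow_pos hq le_rfl)

theorem gaussian_eq_zero {q m r : ℕ} (hr : m < r) : gaussian q m r = 0 := by
  rw [gaussian, Finset.prod_eq_zero (Finset.mem_range.2 hr) (sub_self _), zero_div]

theorem gaussian_nonneg {q m r : ℕ} (hq : 2 ≤ q) : 0 ≤ gaussian q m r := by
  rcases le_or_gt r m with h | h
  · exact (gaussian_pos hq h).le
  · exact (gaussian_eq_zero h).ge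

theorem gaussian_self {q m : ℕ} (hq : 2 ≤ q) : gaussian q m m = 1 :=
  div_self (prod_pow_sub_pow_pos hq le_rfl).ne'

/-! ### Counting subspaces -/

section Subspaces

variable {F E : Type*} [Field F] [AddCommGroup E] [Module F E] [Finite E]

theorem sup_span_eq_of_mem_indepTuples {m : ℕ} {W V : Submodule F E} {s : Fin m → E}
    (hs : s ∈ indepTuples W V m) (hWV : W ≤ V) (hd : finrank F V = finrank F W + m) :
    W ⊔ Submodule.span F (Set.range s) = V :=
  Submodule.eq_of_le_of_finrank_eq (sup_le hWV (span_range_le hs.1))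
    (by rw [finrank_sup_span_range hs.2, hd])

variable [Fintype F]

/-- The number of `V ≤ Y` with `V ⊓ M = W` and `dim V = dim W + m`. -/
theorem ncard_submodule_inf_eq {W M Y : Submodule F E} (hWM : W ≤ M) (hMY : M ≤ Y) (m : ℕ) :
    (({V : Submodule F E | V ≤ Y ∧ finrank F V = finrank F W + m ∧ V ⊓ M = W}.ncard : ℕ) : ℚ) =
      (Fintype.card F : ℚ) ^ ((finrank F M - finrank F W) * m) *
        gaussian (Fintype.card F) (finrank F Y - finrank F M) m := by
  set q := Fintype.card F with hq
  have h2 : 2 ≤ q := Fintype.one_lt_card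
  have hfib : (indepTuples M Y m).ncard =
      {V : Submodule F E | V ≤ Y ∧ finrank F V = finrank F W + m ∧ V ⊓ M = W}.ncard *
        ∏ i ∈ Finset.range m, (q ^ (finrank F W + m) - q ^ (finrank F W + i)) := by
    -- Every such `V` is spanned by `W` and an `m`-tuple independent modulo `M`. For tuples in `V`,
    -- independence modulo `M` and modulo `W` agree, since `V ⊓ M = W`; hence all fibres have the
    -- same size.
    refine ncard_eq_mul_of_fiber (fun s => W ⊔ Submodule.span F (Set.range s)) _
      (fun s hs => ?_) (fun V hV => ?_)
    · have hind := (linearIndependent_mkQ_iff M s).1 hs.2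
      refine ⟨sup_le (hWM.trans hMY) (span_range_le hs.1), finrank_sup_span_range ?_, ?_⟩
      · exact (linearIndependent_mkQ_iff W s).2 fun c hc => hind c (hWM hc)
      · refine le_antisymm ?_ (le_inf le_sup_left hWM)
        rintro x ⟨hx, hxM⟩
        obtain ⟨w, hw, z, hz, rfl⟩ := Submodule.mem_sup.1 hx
        obtain ⟨c, rfl⟩ := (Submodule.mem_span_range_iff_exists_fun F).1 hz
        have := hind c ((Submodule.add_mem_iff_right M (hWM hw)).1 hxM)
        simpa [this] using hw
    · obtain ⟨hVY, hVd, hVM⟩ := hV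
      have hWV : W ≤ V := hVM ▸ inf_le_left
      have : {s ∈ indepTuples M Y m | W ⊔ Submodule.span F (Set.range s) = V} =
          indepTuples W V m := by
        ext s
        constructor
        · rintro ⟨hs, rfl⟩
          exact ⟨fun i => (le_sup_right : _ ≤ W ⊔ _) (Submodule.subset_span ⟨i, rfl⟩),
            (linearIndependent_mkQ_iff W s).2 fun c hc =>
              (linearIndependent_mkQ_iff M s).1 hs.2 c (hWM hc)⟩
        · intro hs
          refine ⟨⟨fun i => hVY (hs.1 i), (linearIndependent_mkQ_iff M s).2 fun c hc =>
            (linearIndependent_mkQ_iff W s).1 hs.2 c ?_⟩,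
            sup_span_eq_of_mem_indepTuples hs hWV hVd⟩
          rw [← hVM]
          exact ⟨Submodule.sum_mem _ fun i _ => Submodule.smul_mem _ _ (hs.1 i), hc⟩
      rw [this, ncard_indepTuples hWV, hVd]
  rw [ncard_indepTuples hMY] at hfib
  have hc := congrArg (Nat.cast : ℕ → ℚ) hfib
  rw [Nat.cast_mul, cast_prod_pow_sub_pow (by omega) (Submodule.finrank_mono hMY),
    cast_prod_pow_sub_pow (by omega) (by omega), Nat.add_sub_cancel_left] at hc
  have hpos := prod_pow_sub_pow_pos h2 (le_refl m)
  have hq0 : (q : ℚ) ≠ 0 := by positivity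
  have hsplit : (q : ℚ) ^ (finrank F M * m) =
      (q : ℚ) ^ ((finrank F M - finrank F W) * m) * (q : ℚ) ^ (finrank F W * m) := by
    rw [← pow_add, ← add_mul, Nat.sub_add_cancel (Submodule.finrank_mono hWM)]
  rw [hsplit] at hc
  rw [gaussian, ← mul_div_assoc, eq_div_iff hpos.ne']
  refine mul_left_cancel₀ (pow_ne_zero (finrank F W * m) hq0) ?_
  linear_combination -hc

end Subspaces

/-! ### Subspaces of a sum of two subspaces with prescribed traces on both. -/

section Sums

variable {F E : Type*} [Field F] [AddCommGroup E] [Module F E]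

theorem sum_smul_add_eq {t : ℕ} (c : Fin t → F) (x y : Fin t → E) :
    ∑ i, c i • (x + y) i = ∑ i, c i • x i + ∑ i, c i • y i := by
  simp [Finset.sum_add_distrib]

theorem sum_smul_mem {t : ℕ} {U : Submodule F E} (c : Fin t → F) {x : Fin t → E}
    (hx : ∀ i, x i ∈ U) : ∑ i, c i • x i ∈ U :=
  Submodule.sum_mem _ fun i _ => Submodule.smul_mem _ _ (hx i)

/-- The tuples of `U₁ ⊔ U₂` whose components in `U₁`, `U₂` are independent modulo `A`, `B`. -/
def splitTuples (U₁ U₂ A B : Submodule F E) (t : ℕ) : Set (Fin t → E) :=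
  {z | ∃ x ∈ indepTuples A U₁ t, ∃ y ∈ indepTuples B U₂ t, x + y = z}

theorem mem_indepTuples_sup_of_mem_splitTuples {U₀ U₁ U₂ A B : Submodule F E} {t : ℕ}
    (h12 : U₁ ⊓ U₂ = U₀) (hA0 : U₀ ≤ A) (hA : A ≤ U₁) (hB : B ≤ U₂)
    {z : Fin t → E} (hz : z ∈ splitTuples U₁ U₂ A B t) :
    z ∈ indepTuples (A ⊔ B) (U₁ ⊔ U₂) t := by
  obtain ⟨x, hx, y, hy, rfl⟩ := hz
  refine ⟨fun i => Submodule.add_mem_sup (hx.1 i) (hy.1 i),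
    (linearIndependent_mkQ_iff _ _).2 fun c hc => (linearIndependent_mkQ_iff _ _).1 hx.2 c ?_⟩
  rw [sum_smul_add_eq] at hc
  obtain ⟨a, ha, b, hb, hab⟩ := Submodule.mem_sup.1 hc
  have h0 : ∑ i, c i • x i - a ∈ U₀ := by
    rw [← h12]
    refine ⟨Submodule.sub_mem _ (sum_smul_mem c hx.1) (hA ha), ?_⟩
    have : ∑ i, c i • x i - a = b - ∑ i, c i • y i := by
      rw [sub_eq_sub_iff_add_eq_add, ← hab, add_comm]
    rw [this]
    exact Submodule.sub_mem _ (hB hb) (sum_smul_mem c hy.1)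
  simpa using A.add_mem (hA0 h0) ha

/-- Any decomposition `z = x + y` works: a combination of the `x i` lying in `Y` forces the same
combination of the `y i` into `Y`, so the combination of the `z i` lies in `Y ⊓ U₁ ⊔ Y ⊓ U₂` and is
trivial. -/
theorem mem_splitTuples_of_mem_indepTuples {U₁ U₂ Y : Submodule F E} {t : ℕ} (hY : Y ≤ U₁ ⊔ U₂)
    {z : Fin t → E} (hz : z ∈ indepTuples (Y ⊓ U₁ ⊔ Y ⊓ U₂) Y t) :
    z ∈ splitTuples U₁ U₂ (Y ⊓ U₁) (Y ⊓ U₂) t := by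
  choose x hx y hy hxy using fun i => Submodule.mem_sup.1 (hY (hz.1 i))
  have hxy' : x + y = z := funext hxy
  have hind := (linearIndependent_mkQ_iff _ _).1 hz.2
  have hmem : ∀ c : Fin t → F, ∑ i, c i • x i + ∑ i, c i • y i ∈ Y := fun c => by
    rw [← sum_smul_add_eq, hxy']
    exact sum_smul_mem c hz.1
  refine ⟨x, ⟨hx, (linearIndependent_mkQ_iff _ _).2 fun c hc => hind c ?_⟩,
    y, ⟨hy, (linearIndependent_mkQ_iff _ _).2 fun c hc => hind c ?_⟩, hxy'⟩ <;>
  rw [← hxy', sum_smul_add_eq]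
  · exact Submodule.add_mem_sup hc
      ⟨(Submodule.add_mem_iff_right Y hc.1).1 (hmem c), sum_smul_mem c hy⟩
  · exact Submodule.add_mem_sup
      ⟨(Submodule.add_mem_iff_left Y hc.1).1 (hmem c), sum_smul_mem c hx⟩ hc

/-- If `a + b + ∑ c i • (x i + y i)` lies in `U₁`, then `b + ∑ c i • y i` lies in `U₁ ⊓ U₂ = U₀ ≤
B`, so independence of `y` modulo `B` kills `c`, and the remaining `b` is in `U₀ ≤ A`. -/
theorem sup_sup_span_inf_eq {U₀ U₁ U₂ A B : Submodule F E} {t : ℕ}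
    (h12 : U₁ ⊓ U₂ = U₀) (hA0 : U₀ ≤ A) (hA : A ≤ U₁) (hB0 : U₀ ≤ B) (hB : B ≤ U₂)
    {x y : Fin t → E} (hx : ∀ i, x i ∈ U₁) (hy : y ∈ indepTuples B U₂ t) :
    (A ⊔ B ⊔ Submodule.span F (Set.range (x + y))) ⊓ U₁ = A := by
  refine le_antisymm ?_ (le_inf (le_sup_left.trans le_sup_left) hA)
  rintro v ⟨hv, hv1⟩
  obtain ⟨w, hw, z, hz, rfl⟩ := Submodule.mem_sup.1 hv
  obtain ⟨a, ha, b, hb, rfl⟩ := Submodule.mem_sup.1 hw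
  obtain ⟨c, rfl⟩ := (Submodule.mem_span_range_iff_exists_fun F).1 hz
  have hb1 : ∀ b' ∈ U₂, a + b' ∈ U₁ → b' ∈ U₀ := fun b' hb' h => by
    rw [← h12]
    exact ⟨(Submodule.add_mem_iff_right U₁ (hA ha)).1 h, hb'⟩
  rw [sum_smul_add_eq] at hv1
  have hc : c = 0 := by
    refine (linearIndependent_mkQ_iff _ _).1 hy.2 c ?_
    refine (Submodule.add_mem_iff_right B hb).1 (hB0 (hb1 _
      (Submodule.add_mem _ (hB hb) (sum_smul_mem c hy.1)) ?_))
    refine (Submodule.add_mem_iff_left U₁ (sum_smul_mem c hx)).1 ?_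
    rw [add_assoc, add_assoc, add_comm (∑ i, c i • y i), ← add_assoc]
    exact hv1
  subst hc
  simp only [Pi.zero_apply, zero_smul, Finset.sum_const_zero, add_zero] at hv1 ⊢
  exact A.add_mem ha (hA0 (hb1 b (hB hb) hv1))

variable [Finite E]

theorem finrank_sup_eq_of_inf_le {U₀ U₁ U₂ A B : Submodule F E} (h12 : U₁ ⊓ U₂ = U₀)
    (hA0 : U₀ ≤ A) (hA : A ≤ U₁) (hB0 : U₀ ≤ B) (hB : B ≤ U₂) :
    finrank F ↥(A ⊔ B) + finrank F U₀ = finrank F A + finrank F B := by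
  rw [← Submodule.finrank_sup_add_finrank_inf_eq A B,
    le_antisymm ((inf_le_inf hA hB).trans h12.le) (le_inf hA0 hB0)]

variable [Fintype F]

/-- The decompositions of a fixed sum are the pairs `(x + d, y - d)` with `d` a tuple in `U₀`; since
`U₀` lies in both `A` and `B`, such a shift preserves independence. -/
theorem ncard_indepTuples_mul {U₀ U₁ U₂ A B : Submodule F E} (h12 : U₁ ⊓ U₂ = U₀)
    (hA0 : U₀ ≤ A) (hB0 : U₀ ≤ B) (t : ℕ) :
    (indepTuples A U₁ t).ncard * (indepTuples B U₂ t).ncard =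
      (splitTuples U₁ U₂ A B t).ncard * Fintype.card F ^ (finrank F U₀ * t) := by
  rw [← Set.ncard_prod, ← ncard_tuples U₀ t]
  refine ncard_eq_mul_of_fiber (fun p => p.1 + p.2) _
    (fun p hp => ⟨p.1, hp.1, p.2, hp.2, rfl⟩) ?_
  rintro z ⟨x, hx, y, hy, rfl⟩
  have hinj : Function.Injective fun d : Fin t → E => ((x + d, y - d) : (Fin t → E) × _) :=
    fun d d' h => add_left_cancel (Prod.ext_iff.1 h).1
  rw [← Set.ncard_image_of_injective _ hinj]
  congr 1
  have h01 : U₀ ≤ U₁ := h12 ▸ inf_le_left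
  have h02 : U₀ ≤ U₂ := h12 ▸ inf_le_right
  ext ⟨x', y'⟩
  constructor
  · rintro ⟨⟨hx', hy'⟩, h⟩
    refine ⟨x' - x, fun i => ?_, ?_⟩
    · rw [← h12]
      refine ⟨Submodule.sub_mem _ (hx'.1 i) (hx.1 i), ?_⟩
      have : (x' - x) i = y i - y' i := by
        have := congrFun h i
        simp only [Pi.add_apply] at this
        rw [Pi.sub_apply, sub_eq_sub_iff_add_eq_add, this, add_comm]
      rw [this]
      exact Submodule.sub_mem _ (hy.1 i) (hy'.1 i)
    · refine Prod.ext (by simp) ?_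
      have h : x' + y' = x + y := h
      change y - (x' - x) = y'
      rw [sub_eq_iff_eq_add, ← add_sub_assoc, eq_sub_iff_add_eq, add_comm y, ← h, add_comm]
  · rintro ⟨d, hd, h⟩
    obtain ⟨rfl, rfl⟩ := Prod.ext_iff.1 h
    have hQ : ∀ {A : Submodule F E}, U₀ ≤ A → ∀ i, A.mkQ (d i) = 0 := fun hA i =>
      (Submodule.Quotient.mk_eq_zero _).2 (hA (hd i))
    refine ⟨⟨⟨fun i => U₁.add_mem (hx.1 i) (h01 (hd i)), ?_⟩,
      ⟨fun i => U₂.sub_mem (hy.1 i) (h02 (hd i)), ?_⟩⟩, by simp⟩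
    · convert hx.2 using 1
      ext i
      simpa using hQ hA0 i
    · convert hy.2 using 1
      ext i
      simpa using hQ hB0 i

/-- The number of `Y ≤ U₁ ⊔ U₂` of a given dimension that meet `U₁`, `U₂` in given subspaces
`A`, `B` containing `U₁ ⊓ U₂`. -/
theorem ncard_submodule_inf_inf_eq {U₀ U₁ U₂ A B : Submodule F E} (h12 : U₁ ⊓ U₂ = U₀)
    (hA0 : U₀ ≤ A) (hA : A ≤ U₁) (hB0 : U₀ ≤ B) (hB : B ≤ U₂) (t : ℕ) :
    (({Y : Submodule F E | Y ≤ U₁ ⊔ U₂ ∧ finrank F Y = finrank F ↥(A ⊔ B) + t ∧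
        Y ⊓ U₁ = A ∧ Y ⊓ U₂ = B}.ncard : ℕ) : ℚ) =
      (∏ i ∈ Finset.range t, ((Fintype.card F : ℚ) ^ t - (Fintype.card F : ℚ) ^ i)) *
        gaussian (Fintype.card F) (finrank F U₁ - finrank F A) t *
        gaussian (Fintype.card F) (finrank F U₂ - finrank F B) t := by
  set q := Fintype.card F with hq
  have h2 : 2 ≤ q := Fintype.one_lt_card
  have hfib : (splitTuples U₁ U₂ A B t).ncard =
      {Y : Submodule F E | Y ≤ U₁ ⊔ U₂ ∧ finrank F Y = finrank F ↥(A ⊔ B) + t ∧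
        Y ⊓ U₁ = A ∧ Y ⊓ U₂ = B}.ncard *
        ∏ i ∈ Finset.range t,
          (q ^ (finrank F ↥(A ⊔ B) + t) - q ^ (finrank F ↥(A ⊔ B) + i)) := by
    -- The fibre over `Y` is all of `indepTuples (A ⊔ B) Y t`: a tuple of `Y` independent modulo `A
    -- ⊔ B` splits automatically.
    refine ncard_eq_mul_of_fiber (fun s => A ⊔ B ⊔ Submodule.span F (Set.range s)) _
      (fun s hs => ?_) (fun Y hY => ?_)
    · have hs' := mem_indepTuples_sup_of_mem_splitTuples h12 hA0 hA hB hs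
      refine ⟨sup_le (sup_le_sup hA hB) (span_range_le hs'.1), finrank_sup_span_range hs'.2, ?_⟩
      obtain ⟨x, hx, y, hy, rfl⟩ := hs
      refine ⟨sup_sup_span_inf_eq h12 hA0 hA hB0 hB hx.1 hy, ?_⟩
      rw [sup_comm A B, add_comm x y]
      exact sup_sup_span_inf_eq (inf_comm U₁ U₂ ▸ h12) hB0 hB hA0 hA hy.1 hx
    · obtain ⟨hY12, hYd, hYA, hYB⟩ := hY
      have hABY : A ⊔ B ≤ Y := sup_le (hYA ▸ inf_le_left) (hYB ▸ inf_le_left)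
      have : {s ∈ splitTuples U₁ U₂ A B t | A ⊔ B ⊔ Submodule.span F (Set.range s) = Y} =
          indepTuples (A ⊔ B) Y t := by
        ext s
        constructor
        · rintro ⟨hs, rfl⟩
          exact ⟨fun i => (le_sup_right : _ ≤ (A ⊔ B) ⊔ _) (Submodule.subset_span ⟨i, rfl⟩),
            (mem_indepTuples_sup_of_mem_splitTuples h12 hA0 hA hB hs).2⟩
        · intro hs
          refine ⟨?_, sup_span_eq_of_mem_indepTuples hs hABY hYd⟩
          subst hYA hYB
          exact mem_splitTuples_of_mem_indepTuples hY12 hs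
      rw [this, ncard_indepTuples hABY, hYd]
  have hmul := ncard_indepTuples_mul h12 hA0 hB0 t
  rw [hfib, ncard_indepTuples hA, ncard_indepTuples hB] at hmul
  have hc := congrArg (Nat.cast : ℕ → ℚ) hmul
  rw [Nat.cast_mul, Nat.cast_mul, Nat.cast_mul, Nat.cast_pow,
    cast_prod_pow_sub_pow (by omega) (Submodule.finrank_mono hA),
    cast_prod_pow_sub_pow (by omega) (Submodule.finrank_mono hB),
    cast_prod_pow_sub_pow (by omega) (by omega), Nat.add_sub_cancel_left] at hc
  have hpos := prod_pow_sub_pow_pos h2 (le_refl t)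
  have hq0 : (q : ℚ) ≠ 0 := by positivity
  have hsplit : (q : ℚ) ^ (finrank F A * t) * (q : ℚ) ^ (finrank F B * t) =
      (q : ℚ) ^ (finrank F ↥(A ⊔ B) * t) * (q : ℚ) ^ (finrank F U₀ * t) := by
    rw [← pow_add, ← pow_add, ← add_mul, ← add_mul,
      finrank_sup_eq_of_inf_le h12 hA0 hA hB0 hB]
  rw [gaussian, gaussian]
  have hne := pow_ne_zero (finrank F ↥(A ⊔ B) * t) hq0
  have hne' := pow_ne_zero (finrank F U₀ * t) hq0
  field_simp
  refine mul_left_cancel₀ (mul_ne_zero hne hne') ?_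
  rw [mul_mul_mul_comm, ← hq, hsplit] at hc
  linear_combination -hc

end Sums

/-! ### Counting subspaces by their intersection dimensions with two petals and their core. -/

theorem cast_ncard_eq_mul_of_fiber {α β : Type*} [Finite α] [Finite β] {S : Set α} {T : Set β}
    (f : α → β) (c : ℚ) (hf : ∀ a ∈ S, f a ∈ T)
    (hc : ∀ b ∈ T, ({a ∈ S | f a = b}.ncard : ℚ) = c) : (S.ncard : ℚ) = T.ncard * c := by
  classical
  have := Fintype.ofFinite β
  rw [ncard_eq_sum_ncard_fiber T.toFinset f (fun a ha => by simpa using hf a ha), Nat.cast_sum,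
    Finset.sum_congr rfl (fun b hb => hc b (by simpa using hb)), Finset.sum_const,
    Set.ncard_eq_toFinset_card', nsmul_eq_mul]

section Sunflower

variable {F E : Type*} [Field F] [AddCommGroup E] [Module F E] [Finite E]

/-- By the modular law `(W ⊔ U₀) ⊓ U = (W ⊓ U) ⊔ U₀`. This transfers intersection dimensions between
`W` and `W ⊔ U₀`. -/
theorem finrank_inf_add_finrank {U₀ U : Submodule F E} (h : U₀ ≤ U) (W : Submodule F E) :
    finrank F ↥(W ⊓ U) + finrank F U₀ =
      finrank F ↥((W ⊔ U₀) ⊓ U) + finrank F ↥(W ⊓ U₀) := by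
  rw [sup_comm, sup_inf_assoc_of_le W h, sup_comm,
    ← Submodule.finrank_sup_add_finrank_inf_eq (W ⊓ U) U₀, inf_assoc, inf_eq_right.2 h]

variable [Fintype F]

/-- The number of intermediate spaces of `U₀ ≤ U₁ ⊔ U₂` with given intersection dimensions. -/
theorem ncard_between_eq_countDirect {U₀ U₁ U₂ : Submodule F E} (h12 : U₁ ⊓ U₂ = U₀)
    (b₁ b₂ t : ℕ) :
    (({Y : Submodule F E | U₀ ≤ Y ∧ Y ≤ U₁ ⊔ U₂ ∧ finrank F Y = finrank F U₀ + b₁ + b₂ + t ∧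
        finrank F ↥(Y ⊓ U₁) = finrank F U₀ + b₁ ∧
        finrank F ↥(Y ⊓ U₂) = finrank F U₀ + b₂}.ncard : ℕ) : ℚ) =
      countDirect (Fintype.card F) t (finrank F U₁ - finrank F U₀)
        (finrank F U₂ - finrank F U₀) b₁ b₂ := by
  have h01 : U₀ ≤ U₁ := h12 ▸ inf_le_left
  have h02 : U₀ ≤ U₂ := h12 ▸ inf_le_right
  -- The conditions `A ⊓ U₀ = U₀` and `B ⊓ U₀ = U₀` encode containment of `U₀` in the shape counted
  -- by `ncard_submodule_inf_eq` with `W = M = U₀`.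
  rw [cast_ncard_eq_mul_of_fiber (fun Y => (Y ⊓ U₁, Y ⊓ U₂))
    (T := {A : Submodule F E | A ≤ U₁ ∧ finrank F A = finrank F U₀ + b₁ ∧ A ⊓ U₀ = U₀} ×ˢ
      {B : Submodule F E | B ≤ U₂ ∧ finrank F B = finrank F U₀ + b₂ ∧ B ⊓ U₀ = U₀})
    ((∏ i ∈ Finset.range t, ((Fintype.card F : ℚ) ^ t - (Fintype.card F : ℚ) ^ i)) *
      gaussian (Fintype.card F) (finrank F U₁ - finrank F U₀ - b₁) t *
      gaussian (Fintype.card F) (finrank F U₂ - finrank F U₀ - b₂) t)]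
  · rw [Set.ncard_prod, Nat.cast_mul, ncard_submodule_inf_eq le_rfl h01,
      ncard_submodule_inf_eq le_rfl h02, countDirect]
    simp only [Nat.sub_self, zero_mul, pow_zero, one_mul]
    ring
  · rintro Y ⟨h0, -, -, h1, h2⟩
    exact ⟨⟨inf_le_right, h1, inf_eq_right.2 (le_inf h0 h01)⟩,
      ⟨inf_le_right, h2, inf_eq_right.2 (le_inf h0 h02)⟩⟩
  · rintro ⟨A, B⟩ ⟨⟨hA, hAd, hA0⟩, ⟨hB, hBd, hB0⟩⟩
    simp only [inf_eq_right] at hA hAd hA0 hB hBd hB0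
    have hAB := finrank_sup_eq_of_inf_le h12 hA0 hA hB0 hB
    have := ncard_submodule_inf_inf_eq h12 hA0 hA hB0 hB t
    rw [hAd, hBd, ← Nat.sub_sub, ← Nat.sub_sub] at this
    rw [← this]
    congr 2
    ext Y
    simp only [Set.mem_ofPred_eq, Prod.mk.injEq]
    constructor
    · rintro ⟨⟨-, h, hd, -, -⟩, rfl, rfl⟩
      exact ⟨h, by omega, rfl, rfl⟩
    · rintro ⟨h, hd, rfl, rfl⟩
      exact ⟨⟨hA0.trans inf_le_left, h, by omega, hAd, hBd⟩, rfl, rfl⟩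

/-- The number of subspaces of `U₁ ⊔ U₂` with given intersection dimensions. -/
theorem ncard_le_sup_eq_countSum {U₀ U₁ U₂ : Submodule F E} (h12 : U₁ ⊓ U₂ = U₀)
    (v₀ b₁ b₂ t : ℕ) :
    (({W : Submodule F E | W ≤ U₁ ⊔ U₂ ∧ finrank F W = v₀ + b₁ + b₂ + t ∧
        finrank F ↥(W ⊓ U₀) = v₀ ∧ finrank F ↥(W ⊓ U₁) = v₀ + b₁ ∧
        finrank F ↥(W ⊓ U₂) = v₀ + b₂}.ncard : ℕ) : ℚ) =
      countSum (Fintype.card F) t (finrank F U₀) (finrank F U₁) (finrank F U₂)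
        v₀ (v₀ + b₁) (v₀ + b₂) := by
  have h01 : U₀ ≤ U₁ := h12 ▸ inf_le_left
  have h02 : U₀ ≤ U₂ := h12 ▸ inf_le_right
  have h2 : 2 ≤ Fintype.card F := Fintype.one_lt_card
  rw [cast_ncard_eq_mul_of_fiber (fun W => (W ⊓ U₀, W ⊔ U₀))
    (T := {Z : Submodule F E | Z ≤ U₀ ∧ finrank F Z = finrank F (⊥ : Submodule F E) + v₀ ∧
        Z ⊓ ⊥ = ⊥} ×ˢ
      {Y : Submodule F E | U₀ ≤ Y ∧ Y ≤ U₁ ⊔ U₂ ∧ finrank F Y = finrank F U₀ + b₁ + b₂ + t ∧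
        finrank F ↥(Y ⊓ U₁) = finrank F U₀ + b₁ ∧ finrank F ↥(Y ⊓ U₂) = finrank F U₀ + b₂})
    ((Fintype.card F : ℚ) ^ ((finrank F U₀ - v₀) * (t + b₁ + b₂)))]
  · rw [Set.ncard_prod, Nat.cast_mul, ncard_submodule_inf_eq le_rfl bot_le,
      ncard_between_eq_countDirect h12, countSum]
    simp only [Nat.sub_self, zero_mul, pow_zero, one_mul, finrank_bot, Nat.sub_zero,
      Nat.add_sub_cancel_left]
    ring
  · rintro W ⟨h, hd, hd0, hd1, hd2⟩
    have hs := Submodule.finrank_sup_add_finrank_inf_eq W U₀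
    have hs1 := finrank_inf_add_finrank h01 W
    have hs2 := finrank_inf_add_finrank h02 W
    refine ⟨⟨inf_le_right, by rw [finrank_bot, zero_add]; exact hd0, inf_bot_eq _⟩,
      ⟨le_sup_right, sup_le h (h01.trans le_sup_left), ?_, ?_, ?_⟩⟩ <;> dsimp only <;> omega
  · rintro ⟨Z, Y⟩ ⟨⟨hZ, hZd, -⟩, ⟨h0, hY, hYd, hY1, hY2⟩⟩
    simp only [finrank_bot, zero_add] at hZ hZd h0 hY hYd hY1 hY2
    -- The fibre consists of the `W ≤ Y` with `W ⊓ U₀ = Z` and `W ⊔ U₀ = Y`. The dimension `t + b₁ +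
    -- b₂` is all of `finrank F Y - finrank F U₀`, so the Gaussian factor is `1` and the condition
    -- on the sum is automatic.
    have := ncard_submodule_inf_eq hZ h0 (t + b₁ + b₂)
    have hYd' : finrank F Y - finrank F U₀ = t + b₁ + b₂ := by omega
    rw [hYd', gaussian_self h2, mul_one, hZd] at this
    rw [← this]
    congr 2
    ext W
    simp only [Set.mem_ofPred_eq, Prod.mk.injEq]
    have hs := Submodule.finrank_sup_add_finrank_inf_eq W U₀
    have hs1 := finrank_inf_add_finrank h01 W
    have hs2 := finrank_inf_add_finrank h02 W
    constructor
    · rintro ⟨⟨-, hd, -, -, -⟩, rfl, rfl⟩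
      exact ⟨le_sup_left, by omega, rfl⟩
    · rintro ⟨hWY, hd, rfl⟩
      have hsup : W ⊔ U₀ = Y :=
        Submodule.eq_of_le_of_finrank_eq (sup_le hWY h0) (by omega)
      rw [hsup] at hs1 hs2
      refine ⟨⟨hWY.trans hY, ?_, ?_, ?_, ?_⟩, rfl, hsup⟩ <;> omega

/-- The number of subspaces with given intersection dimensions. -/
theorem ncard_eq_countSubspaces {U₀ U₁ U₂ : Submodule F E} (h12 : U₁ ⊓ U₂ = U₀)
    {l v₀ v₁ v₂ : ℕ} (hv₁ : v₀ ≤ v₁) (hv₂ : v₀ ≤ v₂) :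
    (({V : Submodule F E | finrank F V = l ∧ finrank F ↥(V ⊓ U₀) = v₀ ∧
        finrank F ↥(V ⊓ U₁) = v₁ ∧ finrank F ↥(V ⊓ U₂) = v₂}.ncard : ℕ) : ℚ) =
      countSubspaces (Fintype.card F) (finrank F E) (finrank F U₀) (finrank F U₁)
        (finrank F U₂) l v₀ v₁ v₂ := by
  have h01 : U₀ ≤ U₁ := h12 ▸ inf_le_left
  have h02 : U₀ ≤ U₂ := h12 ▸ inf_le_right
  have hsup := Submodule.finrank_sup_add_finrank_inf_eq U₁ U₂
  rw [h12] at hsup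
  have hle1 : ∀ V : Submodule F E, V ⊓ (U₁ ⊔ U₂) ⊓ U₁ = V ⊓ U₁ := fun V => by
    rw [inf_assoc, inf_eq_right.2 (le_sup_left : U₁ ≤ U₁ ⊔ U₂)]
  have hle2 : ∀ V : Submodule F E, V ⊓ (U₁ ⊔ U₂) ⊓ U₂ = V ⊓ U₂ := fun V => by
    rw [inf_assoc, inf_eq_right.2 (le_sup_right : U₂ ≤ U₁ ⊔ U₂)]
  have hle0 : ∀ V : Submodule F E, V ⊓ (U₁ ⊔ U₂) ⊓ U₀ = V ⊓ U₀ := fun V => by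
    rw [inf_assoc, inf_eq_right.2 (h01.trans le_sup_left)]
  -- The index `t` is the excess of `V ⊓ (U₁ ⊔ U₂)` over `V ⊓ U₁ ⊔ V ⊓ U₂`. Adding either petal to
  -- the former stays inside `U₁ ⊔ U₂`, which bounds `t` above and keeps it within the range of
  -- summation.
  have hbound : ∀ V : Submodule F E, finrank F ↥(V ⊓ U₀) = v₀ → finrank F ↥(V ⊓ U₁) = v₁ →
      finrank F ↥(V ⊓ U₂) = v₂ →
      v₁ + v₂ ≤ finrank F ↥(V ⊓ (U₁ ⊔ U₂)) + v₀ ∧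
      finrank F ↥(V ⊓ (U₁ ⊔ U₂)) + v₀ ≤ v₁ + v₂ + min (finrank F U₁ - v₁) (finrank F U₂ - v₂) := by
    intro V hd0 hd1 hd2
    have e := Submodule.finrank_sup_add_finrank_inf_eq (V ⊓ U₁) (V ⊓ U₂)
    rw [← inf_inf_distrib_left, h12] at e
    have e' := Submodule.finrank_mono (R := F)
      (sup_le (inf_le_inf_left V le_sup_left) (inf_le_inf_left V le_sup_right) :
        V ⊓ U₁ ⊔ V ⊓ U₂ ≤ V ⊓ (U₁ ⊔ U₂))
    have e1 := Submodule.finrank_sup_add_finrank_inf_eq (V ⊓ (U₁ ⊔ U₂)) U₁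
    have e2 := Submodule.finrank_sup_add_finrank_inf_eq (V ⊓ (U₁ ⊔ U₂)) U₂
    rw [hle1] at e1
    rw [hle2] at e2
    have e1' := Submodule.finrank_mono (R := F)
      (sup_le inf_le_right le_sup_left : V ⊓ (U₁ ⊔ U₂) ⊔ U₁ ≤ U₁ ⊔ U₂)
    have e2' := Submodule.finrank_mono (R := F)
      (sup_le inf_le_right le_sup_right : V ⊓ (U₁ ⊔ U₂) ⊔ U₂ ≤ U₁ ⊔ U₂)
    have e3 := Submodule.finrank_mono (R := F) (inf_le_right : V ⊓ U₀ ≤ U₀)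
    have e4 := Submodule.finrank_mono (R := F) (inf_le_right : V ⊓ U₁ ≤ U₁)
    have e5 := Submodule.finrank_mono (R := F) (inf_le_right : V ⊓ U₂ ≤ U₂)
    omega
  rw [ncard_eq_sum_ncard_fiber
    (Finset.range (min (finrank F U₁ - v₁) (finrank F U₂ - v₂) + 1))
    (fun V => finrank F ↥(V ⊓ (U₁ ⊔ U₂)) + v₀ - (v₁ + v₂)) ?_, Nat.cast_sum, countSubspaces]
  · refine Finset.sum_congr rfl fun t _ => ?_
    split_ifs with hl
    · obtain ⟨b₁, rfl⟩ := Nat.exists_eq_add_of_le hv₁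
      obtain ⟨b₂, rfl⟩ := Nat.exists_eq_add_of_le hv₂
      rw [cast_ncard_eq_mul_of_fiber (fun V => V ⊓ (U₁ ⊔ U₂))
        (T := {W : Submodule F E | W ≤ U₁ ⊔ U₂ ∧ finrank F W = v₀ + b₁ + b₂ + t ∧
          finrank F ↥(W ⊓ U₀) = v₀ ∧ finrank F ↥(W ⊓ U₁) = v₀ + b₁ ∧
          finrank F ↥(W ⊓ U₂) = v₀ + b₂}) _ ?_ ?_, ncard_le_sup_eq_countSum h12, mul_comm]
      · rintro V ⟨⟨hd, hd0, hd1, hd2⟩, ht⟩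
        have := hbound V hd0 hd1 hd2
        refine ⟨inf_le_right, ?_, ?_⟩
        · omega
        · rw [hle0, hle1, hle2]
          exact ⟨hd0, hd1, hd2⟩
      · rintro W ⟨hW, hWd, hd0, hd1, hd2⟩
        have := ncard_submodule_inf_eq hW (le_top : U₁ ⊔ U₂ ≤ ⊤)
          (l + v₀ - (t + (v₀ + b₁) + (v₀ + b₂)))
        rw [finrank_top] at this
        have x1 : finrank F ↥(U₁ ⊔ U₂) - finrank F W = finrank F U₁ + finrank F U₂ + v₀ -
          (finrank F U₀ + (v₀ + b₁) + (v₀ + b₂) + t) := by omega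
        have x2 : finrank F E - finrank F ↥(U₁ ⊔ U₂) =
          finrank F E + finrank F U₀ - (finrank F U₁ + finrank F U₂) := by omega
        rw [x1, x2] at this
        rw [← this]
        congr 2
        ext V
        simp only [Set.mem_ofPred_eq]
        constructor
        · rintro ⟨⟨hd, -⟩, rfl⟩
          exact ⟨le_top, by omega, rfl⟩
        · rintro ⟨-, hd, rfl⟩
          rw [hle0] at hd0
          rw [hle1] at hd1
          rw [hle2] at hd2
          exact ⟨⟨⟨by omega, hd0, hd1, hd2⟩, by omega⟩, rfl⟩
    · rw [Nat.cast_eq_zero, Set.ncard_eq_zero]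
      refine Set.eq_empty_of_forall_notMem ?_
      rintro V ⟨⟨hd, hd0, hd1, hd2⟩, ht⟩
      have := hbound V hd0 hd1 hd2
      have := Submodule.finrank_mono (R := F) (inf_le_left : V ⊓ (U₁ ⊔ U₂) ≤ V)
      omega
  · rintro V ⟨hd, hd0, hd1, hd2⟩
    have := hbound V hd0 hd1 hd2
    rw [Finset.mem_range]
    omega

end Sunflower

/-! ### The Griesmer bound -/

section Griesmer

variable {F : Type*} [Field F] [DecidableEq F]

/-- Off the support of `c` subtracting `a • c` changes nothing; on the support the difference
vanishes exactly where `x` agrees with `a • c`. -/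
theorem hammingNorm_sub_smul_add {ι : Type*} [Fintype ι] (c x : ι → F) (a : F) :
    hammingNorm (x - a • c) + (Finset.univ.filter fun i => c i ≠ 0 ∧ x i = a * c i).card =
      hammingNorm (fun i : {i // c i = 0} => x i) + hammingNorm c := by
  classical
  have h1 : hammingNorm (x - a • c) =
      (Finset.univ.filter fun i => c i = 0 ∧ x i ≠ 0).card +
        (Finset.univ.filter fun i => c i ≠ 0 ∧ x i ≠ a * c i).card := by
    rw [hammingNorm, ← Finset.card_union_of_disjoint, ← Finset.filter_or]
    · congr 1
      refine Finset.filter_congr fun i _ => ?_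
      by_cases hc : c i = 0 <;> simp [hc, sub_eq_zero]
    · exact Finset.disjoint_filter.2 fun i _ h h' => h'.1 h.1
  have h2 : hammingNorm c =
      (Finset.univ.filter fun i => c i ≠ 0 ∧ x i ≠ a * c i).card +
        (Finset.univ.filter fun i => c i ≠ 0 ∧ x i = a * c i).card := by
    rw [hammingNorm, ← Finset.card_union_of_disjoint, ← Finset.filter_or]
    · congr 1
      refine Finset.filter_congr fun i _ => ?_
      tauto
    · exact Finset.disjoint_filter.2 fun i _ h h' => h.2 h'.2
  have h3 : hammingNorm (fun i : {i // c i = 0} => x i) =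
      (Finset.univ.filter fun i => c i = 0 ∧ x i ≠ 0).card := by
    rw [hammingNorm, ← Finset.card_map (Function.Embedding.subtype _)]
    congr 1
    ext i
    simp [and_comm]
  omega

variable [Fintype F]

/-- Pigeonhole: the ratio `x i / c i` partitions the support of `c` into at most `q` classes. -/
theorem exists_card_le_mul_card_eq_smul {ι : Type*} [Fintype ι] (c x : ι → F) :
    ∃ a : F, hammingNorm c ≤
      Fintype.card F * (Finset.univ.filter fun i => c i ≠ 0 ∧ x i = a * c i).card := by
  by_contra! hcon
  have hsum : hammingNorm c =
      ∑ a : F, (Finset.univ.filter fun i => c i ≠ 0 ∧ x i = a * c i).card := by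
    rw [hammingNorm, Finset.card_eq_sum_card_fiberwise (f := fun i => x i / c i)
      (t := Finset.univ) (fun _ _ => Finset.mem_coe.2 (Finset.mem_univ _))]
    refine Finset.sum_congr rfl fun a _ => ?_
    rw [Finset.filter_filter]
    congr 1
    refine Finset.filter_congr fun i _ => and_congr_right fun hi => ?_
    rw [div_eq_iff hi]
  have hlt : ∑ a : F, Fintype.card F *
      (Finset.univ.filter fun i => c i ≠ 0 ∧ x i = a * c i).card <
      ∑ _a : F, hammingNorm c :=
    Finset.sum_lt_sum_of_nonempty Finset.univ_nonempty fun a _ => hcon a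
  rw [← Finset.mul_sum, ← hsum, Finset.sum_const, Finset.card_univ, smul_eq_mul] at hlt
  exact lt_irrefl _ hlt

/-- The Griesmer bound. -/
theorem sum_ceilDiv_le_card {ι : Type} [Fintype ι] (C : Submodule F (ι → F)) (d : ℕ)
    (hC : ∀ c ∈ C, c ≠ 0 → d ≤ hammingNorm c) :
    ∑ i ∈ Finset.range (finrank F C), d ⌈/⌉ Fintype.card F ^ i ≤ Fintype.card ι := by
  set q := Fintype.card F with hq
  have hq0 : 0 < q := Fintype.card_pos
  generalize hk : finrank F C = k
  induction k generalizing ι d with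
  | zero => simp
  | succ k ih =>
    classical
    obtain ⟨c₀, hc₀, hne⟩ : ∃ c ∈ C, c ≠ 0 := by
      rw [← Submodule.ne_bot_iff]
      rintro rfl
      simp at hk
    -- Induction passes to the residual code with respect to a word `c` of minimum weight, that is,
    -- the restriction to the zeros of `c`.
    obtain ⟨c, ⟨hc, hc0⟩, hmin⟩ := exists_minimal_of_wellFoundedLT
      (fun w : ℕ => ∃ c ∈ C, c ≠ 0 ∧ hammingNorm c = w) ⟨_, c₀, hc₀, hne, rfl⟩ |>.elim
      (fun w hw => by
        obtain ⟨⟨c, hc, hc0, rfl⟩, hm⟩ := hw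
        exact (⟨c, ⟨hc, hc0⟩, fun x hx hx0 => by
          by_contra! hlt
          exact absurd (hm ⟨x, hx, hx0, rfl⟩ hlt.le) (not_le.2 hlt)⟩ :
          ∃ c, (c ∈ C ∧ c ≠ 0) ∧ ∀ x ∈ C, x ≠ 0 → hammingNorm c ≤ hammingNorm x))
    have hcpos : 0 < hammingNorm c := hammingNorm_pos_iff.2 hc0
    -- Subtract the multiple of `c` agreeing with `x` most often on the support. The difference, if
    -- nonzero, is no lighter than `c`, so the residual weight of `x` is at least the number of
    -- agreements. Hence only multiples of `c` restrict to zero, and the residual code has dimension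
    -- one less and distance at least `d ⌈/⌉ q`.
    have key : ∀ x ∈ C, (∃ a : F, x = a • c) ∨
        hammingNorm c ≤ q * hammingNorm (fun i : {i // c i = 0} => x i) := by
      intro x hx
      obtain ⟨a, ha⟩ := exists_card_le_mul_card_eq_smul c x
      by_cases hy : x - a • c = 0
      · exact Or.inl ⟨a, sub_eq_zero.1 hy⟩
      · have h1 := hmin _ (C.sub_mem hx (C.smul_mem a hc)) hy
        have h2 := hammingNorm_sub_smul_add c x a
        exact Or.inr (ha.trans (Nat.mul_le_mul_left _ (by omega)))
    let ρ : (ι → F) →ₗ[F] ({i // c i = 0} → F) := LinearMap.funLeft F F Subtype.val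
    have hρc : ∀ a : F, ρ (a • c) = 0 := fun a => funext fun i => by
      simp [ρ, LinearMap.funLeft_apply, i.2]
    have hker : LinearMap.ker (ρ.domRestrict C) = Submodule.span F {⟨c, hc⟩} := by
      ext ⟨x, hx⟩
      rw [LinearMap.mem_ker, LinearMap.domRestrict_apply, Submodule.mem_span_singleton]
      constructor
      · intro h
        rcases key x hx with ⟨a, rfl⟩ | h'
        · exact ⟨a, rfl⟩
        · have : (fun i : {i // c i = 0} => x i) = 0 := h
          rw [this, hammingNorm_zero] at h'
          omega
      · rintro ⟨a, ha⟩
        obtain rfl : a • c = x := congrArg Subtype.val ha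
        exact hρc a
    have hrank := LinearMap.finrank_range_add_finrank_ker (ρ.domRestrict C)
    rw [LinearMap.range_domRestrict, hker, hk, finrank_span_singleton
      (fun h => hc0 (congrArg Subtype.val h))] at hrank
    have := ih (C.map ρ) (d ⌈/⌉ q) ?_ (by omega)
    · rw [Finset.sum_range_succ']
      have hcard : Fintype.card ι = Fintype.card {i // c i = 0} + hammingNorm c := by
        rw [hammingNorm, Fintype.card_subtype, Finset.card_filter_add_card_filter_not,
          Finset.card_univ]
      have hceil : ∀ i, d ⌈/⌉ q ^ (i + 1) = (d ⌈/⌉ q) ⌈/⌉ q ^ i := fun i =>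
        eq_of_forall_ge_iff fun x => by
          rw [ceilDiv_le_iff_le_mul (pow_pos hq0 _), ceilDiv_le_iff_le_mul (pow_pos hq0 _),
            ceilDiv_le_iff_le_mul hq0, pow_succ', mul_assoc]
      simp only [hceil, pow_zero, ceilDiv_one]
      have := hC c hc hc0
      omega
    · rintro _ ⟨x, hx, rfl⟩ hne
      rw [ceilDiv_le_iff_le_mul hq0]
      rcases key x hx with ⟨a, rfl⟩ | h'
      · exact absurd (hρc a) hne
      · exact (hC c hc hc0).trans h'

theorem mul_geom_sum_reflect (q : ℤ) (a : ℕ) :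
    (q - 1) * ∑ j ∈ Finset.range a, q ^ (a - 1 - j) = q ^ a - 1 := by
  rw [Finset.sum_range_reflect (fun j => q ^ j), mul_geom_sum]

/-- For `j < m` the power `q ^ j` divides `d`, so passing to `d + 1` raises the `j`-th ceiling by
one; these `m` increments give the term `(q - 1) * m`. For larger `j` it suffices that the exponents
`u i ≤ j` cost nothing after rounding up. -/
theorem le_mul_sum_ceilDiv {q k h d m : ℕ} {u : Fin h → ℕ} (hq : 2 ≤ q) (hhq : h ≤ q)
    (hu : ∀ i, 1 ≤ u i) (huk : ∀ i, u i ≤ k) (hm : ∀ i, m ≤ u i) (hm1 : 1 ≤ m) (hmk : m ≤ k)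
    (hd : (d : ℤ) = (q : ℤ) ^ (k - 1) - ∑ i, (q : ℤ) ^ (u i - 1)) :
    (q : ℤ) ^ k - 1 - ∑ i, ((q : ℤ) ^ u i - 1) + (q - 1) * m ≤
      (q - 1) * ∑ j ∈ Finset.range k, (((d + 1) ⌈/⌉ q ^ j : ℕ) : ℤ) := by
  have hq0 : (0 : ℤ) < q := by positivity
  have hterm : ∀ j ∈ Finset.range k,
      (q : ℤ) ^ (k - 1 - j) - ∑ i, (if j < u i then (q : ℤ) ^ (u i - 1 - j) else 0) +
        (if j < m then 1 else 0) ≤ (((d + 1) ⌈/⌉ q ^ j : ℕ) : ℤ) := by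
    intro j hj
    rw [Finset.mem_range] at hj
    have hx : d + 1 ≤ q ^ j * ((d + 1) ⌈/⌉ q ^ j) :=
      (ceilDiv_le_iff_le_mul (by positivity)).1 le_rfl
    generalize (d + 1) ⌈/⌉ q ^ j = x at hx ⊢
    have hx' : (d : ℤ) + 1 ≤ (q : ℤ) ^ j * x := by exact_mod_cast hx
    rw [hd] at hx'
    have hqj : (0 : ℤ) < (q : ℤ) ^ j := by positivity
    have hpow : ∀ a, j < a → (q : ℤ) ^ (a - 1) = (q : ℤ) ^ j * (q : ℤ) ^ (a - 1 - j) :=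
      fun a ha => by rw [← pow_add]; congr 1; omega
    rw [hpow k hj] at hx'
    split_ifs with hjm
    · have : ∑ i, (q : ℤ) ^ (u i - 1) = (q : ℤ) ^ j *
          ∑ i, (if j < u i then (q : ℤ) ^ (u i - 1 - j) else 0) := by
        rw [Finset.mul_sum]
        refine Finset.sum_congr rfl fun i _ => ?_
        rw [if_pos (hjm.trans_le (hm i)), hpow _ (hjm.trans_le (hm i))]
      rw [this] at hx'
      have : (q : ℤ) ^ j * ((q : ℤ) ^ (k - 1 - j) -
          ∑ i, (if j < u i then (q : ℤ) ^ (u i - 1 - j) else 0)) < (q : ℤ) ^ j * x := by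
        linarith
      have := lt_of_mul_lt_mul_left this hqj.le
      linarith
    -- Each petal with `u i ≤ j` contributes at most `q ^ (j - 1)`, and there are at most `h ≤ q` of
    -- them: together at most `q ^ j`, one unit after division, which the strict inequality from `d
    -- + 1` absorbs. Here `j ≥ m ≥ 1`, so `j - 1` is not truncated.
    · have : ∑ i, (q : ℤ) ^ (u i - 1) ≤ (q : ℤ) ^ j *
          ∑ i, (if j < u i then (q : ℤ) ^ (u i - 1 - j) else 0) + (q : ℤ) ^ j := by
        have hle : ∀ i ∈ Finset.univ, (q : ℤ) ^ (u i - 1) ≤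
            (q : ℤ) ^ j * (if j < u i then (q : ℤ) ^ (u i - 1 - j) else 0) +
              (q : ℤ) ^ (j - 1) := by
          intro i _
          have hpos : (0 : ℤ) < (q : ℤ) ^ (j - 1) := by positivity
          split_ifs with hi
          · rw [hpow _ hi]
            linarith
          · rw [mul_zero, zero_add]
            have := hu i
            exact pow_le_pow_right₀ (by linarith) (by omega)
        refine (Finset.sum_le_sum hle).trans ?_
        rw [Finset.sum_add_distrib, ← Finset.mul_sum, Finset.sum_const, Finset.card_univ,
          Fintype.card_fin, nsmul_eq_mul]
        have hj1 : (q : ℤ) ^ j = q * (q : ℤ) ^ (j - 1) := by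
          rw [← pow_succ']
          congr 1
          omega
        have : (h : ℤ) * (q : ℤ) ^ (j - 1) ≤ (q : ℤ) ^ j := by
          rw [hj1]
          exact mul_le_mul_of_nonneg_right (by exact_mod_cast hhq) (by positivity)
        linarith
      have : (q : ℤ) ^ j * ((q : ℤ) ^ (k - 1 - j) -
          ∑ i, (if j < u i then (q : ℤ) ^ (u i - 1 - j) else 0)) < (q : ℤ) ^ j * (x + 1) := by
        linarith
      have := lt_of_mul_lt_mul_left this hqj.le
      linarith
  have hsum := mul_le_mul_of_nonneg_left (Finset.sum_le_sum hterm)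
    (by linarith [show (2 : ℤ) ≤ q by exact_mod_cast hq] : (0 : ℤ) ≤ q - 1)
  refine le_trans (le_of_eq ?_) hsum
  have hfil : ∀ a ≤ k, ∀ f : ℕ → ℤ, ∑ j ∈ Finset.range k, (if j < a then f j else 0) =
      ∑ j ∈ Finset.range a, f j := by
    intro a ha f
    rw [← Finset.sum_filter]
    congr 1
    ext j
    simp only [Finset.mem_filter, Finset.mem_range]
    omega
  have hswap : (q - 1 : ℤ) * ∑ j ∈ Finset.range k,
      ∑ i, (if j < u i then (q : ℤ) ^ (u i - 1 - j) else 0) = ∑ i, ((q : ℤ) ^ u i - 1) := by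
    rw [Finset.sum_comm, Finset.mul_sum]
    refine Finset.sum_congr rfl fun i _ => ?_
    rw [hfil (u i) (huk i), mul_geom_sum_reflect]
  rw [← hswap, Finset.sum_add_distrib, Finset.sum_sub_distrib, mul_add, mul_sub,
    mul_geom_sum_reflect, hfil m hmk, Finset.sum_const, Finset.card_range, nsmul_eq_mul, mul_one]

end Griesmer

/-! ### Orthogonal subspaces for the dot product -/

section Orthogonal

variable {F : Type*} [Field F] {k : ℕ}

/-- The orthogonal of a subspace with respect to the dot product. -/
noncomputable def dotOrthogonal (A : Submodule F (Fin k → F)) : Submodule F (Fin k → F) :=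
  LinearMap.BilinForm.orthogonal (dotProductBilin F F) A

theorem mem_dotOrthogonal {A : Submodule F (Fin k → F)} {v : Fin k → F} :
    v ∈ dotOrthogonal A ↔ ∀ a ∈ A, a ⬝ᵥ v = 0 := Iff.rfl

theorem dotProductBilin_isRefl :
    LinearMap.BilinForm.IsRefl (dotProductBilin F F : LinearMap.BilinForm F (Fin k → F)) :=
  fun a b h => (dotProduct_comm b a).trans h

theorem dotProductBilin_nondegenerate :
    LinearMap.BilinForm.Nondegenerate
      (dotProductBilin F F : LinearMap.BilinForm F (Fin k → F)) :=
  ⟨fun a h => dotProduct_eq_zero a h,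
    fun a h => dotProduct_eq_zero a fun b => (dotProduct_comm a b).trans (h b)⟩

theorem finrank_dotOrthogonal (A : Submodule F (Fin k → F)) :
    finrank F (dotOrthogonal A) = k - finrank F A := by
  rw [dotOrthogonal, LinearMap.BilinForm.finrank_orthogonal dotProductBilin_nondegenerate,
    finrank_fin_fun]

theorem dotOrthogonal_dotOrthogonal (A : Submodule F (Fin k → F)) :
    dotOrthogonal (dotOrthogonal A) = A :=
  LinearMap.BilinForm.orthogonal_orthogonal dotProductBilin_nondegenerate
    dotProductBilin_isRefl A

theorem finrank_le_of_submodule (A : Submodule F (Fin k → F)) : finrank F A ≤ k :=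
  (Submodule.finrank_le A).trans (finrank_fin_fun F).le

theorem le_dotOrthogonal_comm {A B : Submodule F (Fin k → F)} :
    A ≤ dotOrthogonal B ↔ B ≤ dotOrthogonal A :=
  ⟨fun h b hb => mem_dotOrthogonal.2 fun a ha =>
      (dotProduct_comm a b).trans (mem_dotOrthogonal.1 (h ha) b hb),
    fun h a ha => mem_dotOrthogonal.2 fun b hb =>
      (dotProduct_comm b a).trans (mem_dotOrthogonal.1 (h hb) a ha)⟩

theorem mem_dotOrthogonal_span_singleton {a v : Fin k → F} :
    v ∈ dotOrthogonal (Submodule.span F {a}) ↔ a ⬝ᵥ v = 0 := by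
  rw [mem_dotOrthogonal]
  refine ⟨fun h => h a (Submodule.mem_span_singleton_self a), fun h b hb => ?_⟩
  obtain ⟨c, rfl⟩ := Submodule.mem_span_singleton.1 hb
  rw [smul_dotProduct, h, smul_zero]

theorem le_dotOrthogonal_span_singleton {a : Fin k → F} {U : Submodule F (Fin k → F)} :
    U ≤ dotOrthogonal (Submodule.span F {a}) ↔ a ∈ dotOrthogonal U := by
  rw [le_dotOrthogonal_comm, Submodule.span_singleton_le_iff_mem]

end Orthogonal

/-! ### Complements of sunflowers -/

section Complement

variable {F E : Type*} [Field F] [AddCommGroup E] [Module F E] [Finite E]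

open Classical in
theorem finrank_hyperplane_inf {V U : Submodule F E} (hV : finrank F V + 1 = finrank F E) :
    finrank F ↥(V ⊓ U) = if U ≤ V then finrank F U else finrank F U - 1 := by
  split_ifs with h
  · rw [inf_eq_right.2 h]
  · have h1 := Submodule.finrank_sup_add_finrank_inf_eq V U
    have h2 : finrank F V < finrank F ↥(V ⊔ U) :=
      Submodule.finrank_lt_finrank_of_lt (left_lt_sup.2 h)
    have h3 := Submodule.finrank_le (V ⊔ U)
    omega

variable [Fintype F]

/-- Compared vector by vector through indicators: a vector of `V` lies in the core and hence in all
petals, in exactly one petal, or in none. A nonempty index set is needed so that the core is removed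
by the union. -/
theorem ncard_diff_iUnion {ι : Type*} [Fintype ι] {U₀ : Submodule F E} {U : ι → Submodule F E}
    (hU₀ : ∀ i, U₀ ≤ U i) (hU : ∀ i j, i ≠ j → U i ⊓ U j = U₀) [Nonempty ι]
    (V : Submodule F E) :
    (((V : Set E) \ ⋃ i, (U i : Set E)).ncard : ℤ) =
      (Fintype.card F : ℤ) ^ finrank F V - (Fintype.card F : ℤ) ^ finrank F ↥(V ⊓ U₀) -
        ∑ i, ((Fintype.card F : ℤ) ^ finrank F ↥(V ⊓ U i) -
          (Fintype.card F : ℤ) ^ finrank F ↥(V ⊓ U₀)) := by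
  classical
  have := Fintype.ofFinite E
  have hcard : ∀ W : Submodule F E, (Fintype.card F : ℤ) ^ finrank F W =
      ∑ v : E, (if v ∈ W then 1 else 0) := fun W => by
    rw [← Nat.cast_pow, ← ncard_submodule, Set.ncard_eq_toFinset_card', Finset.sum_boole]
    congr 2
    ext v
    simp
  rw [hcard V, hcard (V ⊓ U₀), Finset.sum_congr rfl fun i _ =>
    (by rw [hcard (V ⊓ U i)] : _ = (∑ v : E, (if v ∈ V ⊓ U i then (1 : ℤ) else 0)) -
      ∑ v : E, (if v ∈ V ⊓ U₀ then (1 : ℤ) else 0)),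
    Finset.sum_congr rfl fun i _ => (Finset.sum_sub_distrib ..).symm, Finset.sum_comm,
    ← Finset.sum_sub_distrib, ← Finset.sum_sub_distrib, Set.ncard_eq_toFinset_card']
  have hl : (((V : Set E) \ ⋃ i, (U i : Set E)).toFinset.card : ℤ) =
      ∑ v : E, (if v ∈ V ∧ ∀ i, v ∉ U i then 1 else 0) := by
    rw [Finset.sum_boole]
    congr 2
    ext v
    simp
  rw [hl]
  refine Finset.sum_congr rfl fun v _ => ?_
  by_cases hV : v ∈ V
  swap
  · simp [hV]
  by_cases h0 : v ∈ U₀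
  · have : ∀ i, v ∈ U i := fun i => hU₀ i h0
    simp [hV, h0, this]
  by_cases hi : ∃ i, v ∈ U i
  · obtain ⟨i, hi⟩ := hi
    have hiff : ∀ j, v ∈ U j ↔ j = i := fun j =>
      ⟨fun hj => by
        by_contra hne
        exact h0 (hU j i hne ▸ ⟨hj, hi⟩), fun h => h ▸ hi⟩
    simp [hV, h0, hiff]
  · push Not at hi
    simp [hV, h0, hi]

end Complement

/-! ### Weights in the code of a complement -/

section Weights

variable {F : Type*} [Field F] {k n h : ℕ} {U : Fin h → Submodule F (Fin k → F)}
  {G : Matrix (Fin k) (Fin n) F}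

/-- The `j`-th coordinate of `a G` is the dot product of `a` with the `j`-th column. -/
theorem supportWeight_map (A : Submodule F (Fin k → F)) :
    supportWeight (A.map G.vecMulLinear) = {j | G.col j ∉ dotOrthogonal A}.ncard := by
  rw [supportWeight]
  congr 1
  ext j
  simp only [Set.mem_ofPred_eq, mem_dotOrthogonal, Submodule.mem_map, exists_exists_and_eq_and,
    not_forall, exists_prop]
  rfl

theorem hammingNorm_eq_supportWeight [DecidableEq F] (a : Fin k → F) :
    hammingNorm (G.vecMulLinear a) =
      supportWeight ((Submodule.span F {a}).map G.vecMulLinear) := by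
  classical
  rw [supportWeight_map, hammingNorm, Set.ncard_eq_toFinset_card']
  congr 1
  ext j
  simp only [Finset.mem_filter, Finset.mem_univ, true_and, Set.mem_toFinset, Set.mem_ofPred_eq,
    mem_dotOrthogonal_span_singleton]
  rfl

variable {u₀ : ℕ} {u : Fin h → ℕ} {U₀ : Submodule F (Fin k → F)}

theorem IsSunflower.le (hS : IsSunflower u₀ u U₀ U) (hh : 2 ≤ h) (i : Fin h) : U₀ ≤ U i := by
  have : Nontrivial (Fin h) := Fin.nontrivial_iff_two_le.2 hh
  obtain ⟨j, hj⟩ := exists_ne i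
  rw [← hS.2.2 i j hj.symm]
  exact inf_le_left

variable [Fintype F]

/-- Every admissible vector is a unique nonzero multiple of a unique column, and `P` is invariant
under scaling, so column counts become vector counts up to the factor `q - 1`. -/
theorem ncard_col_mul (hG : IsComplementMatrix U G) (P : (Fin k → F) → Prop)
    (hP : ∀ c : F, c ≠ 0 → ∀ v, P v → P (c • v)) :
    {v : Fin k → F | v ≠ 0 ∧ (∀ i, v ∉ U i) ∧ P v}.ncard =
      (Fintype.card F - 1) * {j | P (G.col j)}.ncard := by
  classical
  have h1 : {c : F | c ≠ 0}.ncard = Fintype.card F - 1 := by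
    rw [Set.ncard_eq_toFinset_card', ← Finset.card_univ,
      ← Finset.card_erase_of_mem (Finset.mem_univ (0 : F))]
    congr 1
    ext c
    simp
  rw [← h1, ← Set.ncard_prod]
  have himg : {v : Fin k → F | v ≠ 0 ∧ (∀ i, v ∉ U i) ∧ P v} =
      (fun p : F × Fin n => p.1 • G.col p.2) '' ({c : F | c ≠ 0} ×ˢ {j | P (G.col j)}) := by
    ext v
    constructor
    · rintro ⟨h0, hU, hv⟩
      obtain ⟨j, ⟨c, hc, rfl⟩, -⟩ := hG.2 v h0 hU
      refine ⟨(c, j), ⟨hc, ?_⟩, rfl⟩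
      have := hP c⁻¹ (inv_ne_zero hc) _ hv
      rwa [inv_smul_smul₀ hc] at this
    · rintro ⟨⟨c, j⟩, ⟨hc, hj⟩, rfl⟩
      exact ⟨smul_ne_zero hc (hG.1 j).1,
        fun i hi => (hG.1 j).2 i (((U i).smul_mem_iff hc).1 hi), hP c hc _ hj⟩
  rw [himg, Set.InjOn.ncard_image]
  rintro ⟨c, j⟩ ⟨hc, -⟩ ⟨c', j'⟩ ⟨hc', -⟩ heq
  have heq : c • G.col j = c' • G.col j' := heq
  obtain ⟨_, -, huniq⟩ := hG.2 (c • G.col j) (smul_ne_zero hc (hG.1 j).1)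
    (fun i hi => (hG.1 j).2 i (((U i).smul_mem_iff hc).1 hi))
  obtain rfl : j = j' := (huniq j ⟨c, hc, rfl⟩).trans (huniq j' ⟨c', hc', heq⟩).symm
  rw [smul_left_injective F (hG.1 j).1 heq]

/-- The number of vectors of `V` outside the petals of a sunflower. -/
theorem IsSunflower.ncard_diff (hS : IsSunflower u₀ u U₀ U) (hh : 2 ≤ h)
    (V : Submodule F (Fin k → F)) :
    (((V : Set (Fin k → F)) \ ⋃ i, (U i : Set (Fin k → F))).ncard : ℤ) =
      (Fintype.card F : ℤ) ^ finrank F V - (Fintype.card F : ℤ) ^ finrank F ↥(V ⊓ U₀) -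
        ∑ i, ((Fintype.card F : ℤ) ^ finrank F ↥(V ⊓ U i) -
          (Fintype.card F : ℤ) ^ finrank F ↥(V ⊓ U₀)) := by
  have : Nonempty (Fin h) := ⟨⟨0, by omega⟩⟩
  exact ncard_diff_iUnion (hS.le hh) hS.2.2 V

theorem IsSunflower.length (hS : IsSunflower u₀ u U₀ U) (hh : 2 ≤ h)
    (hG : IsComplementMatrix U G) :
    ((Fintype.card F : ℤ) - 1) * n = (Fintype.card F : ℤ) ^ k - (Fintype.card F : ℤ) ^ u₀ -
      ∑ i, ((Fintype.card F : ℤ) ^ u i - (Fintype.card F : ℤ) ^ u₀) := by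
  have h1 := ncard_col_mul hG (fun _ => True) (fun _ _ _ _ => trivial)
  have h2 := hS.ncard_diff hh ⊤
  have h3 : ∀ W : Submodule F (Fin k → F), finrank F ↥(⊤ ⊓ W) = finrank F W := fun W => by
    rw [top_inf_eq]
  simp only [h3, hS.1, hS.2.1, finrank_top, finrank_fin_fun] at h2
  rw [← h2]
  have hset : (((⊤ : Submodule F (Fin k → F)) : Set (Fin k → F)) \
      ⋃ i, (U i : Set (Fin k → F))) = {v | v ≠ 0 ∧ (∀ i, v ∉ U i) ∧ True} := by
    ext v
    simp only [Submodule.top_coe, Set.mem_sdiff, Set.mem_univ, Set.mem_iUnion, SetLike.mem_coe,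
      not_exists, true_and, Set.mem_ofPred_eq, and_true]
    refine ⟨fun hv => ⟨?_, hv⟩, fun hv => hv.2⟩
    rintro rfl
    exact hv ⟨0, by omega⟩ (zero_mem _)
  have hcard : {j : Fin n | True}.ncard = n := by
    simp [Set.ncard_univ]
  rw [hset, h1, hcard, Nat.cast_mul, Nat.cast_sub Fintype.card_pos, Nat.cast_one]

theorem IsSunflower.supportWeight_eq (hS : IsSunflower u₀ u U₀ U) (hh : 2 ≤ h)
    (hG : IsComplementMatrix U G) (A : Submodule F (Fin k → F)) :
    ((Fintype.card F : ℤ) - 1) * supportWeight (A.map G.vecMulLinear) =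
      ((Fintype.card F : ℤ) ^ k - (Fintype.card F : ℤ) ^ u₀ -
        ∑ i, ((Fintype.card F : ℤ) ^ u i - (Fintype.card F : ℤ) ^ u₀)) -
      ((Fintype.card F : ℤ) ^ finrank F (dotOrthogonal A) -
        (Fintype.card F : ℤ) ^ finrank F ↥(dotOrthogonal A ⊓ U₀) -
        ∑ i, ((Fintype.card F : ℤ) ^ finrank F ↥(dotOrthogonal A ⊓ U i) -
          (Fintype.card F : ℤ) ^ finrank F ↥(dotOrthogonal A ⊓ U₀))) := by
  have h1 := ncard_col_mul hG (fun v => v ∉ dotOrthogonal A)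
    (fun c hc v hv => by rwa [Submodule.smul_mem_iff _ hc])
  have h2 := hS.ncard_diff hh ⊤
  have h3 : ∀ W : Submodule F (Fin k → F), finrank F ↥(⊤ ⊓ W) = finrank F W := fun W => by
    rw [top_inf_eq]
  simp only [h3, hS.1, hS.2.1, finrank_top, finrank_fin_fun] at h2
  rw [← h2, ← hS.ncard_diff hh]
  have hset : {v : Fin k → F | v ≠ 0 ∧ (∀ i, v ∉ U i) ∧ v ∉ dotOrthogonal A} =
      (((⊤ : Submodule F (Fin k → F)) : Set (Fin k → F)) \ ⋃ i, (U i : Set (Fin k → F))) \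
      ((dotOrthogonal A : Set (Fin k → F)) \ ⋃ i, (U i : Set (Fin k → F))) := by
    ext v
    simp only [Submodule.top_coe, Set.mem_sdiff, Set.mem_univ, Set.mem_iUnion, SetLike.mem_coe,
      not_exists, true_and, Set.mem_ofPred_eq]
    constructor
    · rintro ⟨-, hv, hvA⟩
      exact ⟨hv, fun h => hvA h.1⟩
    · rintro ⟨hv, hvA⟩
      have : v ∉ dotOrthogonal A := fun h => hvA ⟨h, hv⟩
      exact ⟨fun h => this (h ▸ zero_mem _), hv, this⟩
  have hsub : ((dotOrthogonal A : Set (Fin k → F)) \ ⋃ i, (U i : Set (Fin k → F))) ⊆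
      ((⊤ : Submodule F (Fin k → F)) : Set (Fin k → F)) \ ⋃ i, (U i : Set (Fin k → F)) :=
    Set.sdiff_subset_sdiff_left (Set.subset_univ _)
  rw [supportWeight_map, ← Nat.cast_one, ← Nat.cast_sub Fintype.card_pos, ← Nat.cast_mul, ← h1,
    hset, Set.ncard_sdiff hsub, Nat.cast_sub (Set.ncard_le_ncard hsub)]

theorem pow_eq_mul_pow_pred {q : ℤ} {a : ℕ} (ha : 1 ≤ a) : q ^ a = q * q ^ (a - 1) := by
  rw [← pow_succ']
  congr 1
  omega

/-- The hyperplane `a^⊥` does not contain `U₀`, hence contains no petal, and every intersection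
dimension drops by one. -/
theorem IsSunflower.hammingNorm_of_notMem [DecidableEq F] (hS : IsSunflower u₀ u U₀ U)
    (hh : 2 ≤ h) (hu₀ : 1 ≤ u₀) (hlt : ∀ i, u₀ < u i) (hG : IsComplementMatrix U G)
    {a : Fin k → F} (ha0 : a ≠ 0) (ha : a ∉ dotOrthogonal U₀) :
    (hammingNorm (G.vecMulLinear a) : ℤ) = (Fintype.card F : ℤ) ^ (k - 1) +
      ((h : ℤ) - 1) * (Fintype.card F : ℤ) ^ (u₀ - 1) -
        ∑ i, (Fintype.card F : ℤ) ^ (u i - 1) := by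
  have hq : (2 : ℤ) ≤ Fintype.card F := by exact_mod_cast Fintype.one_lt_card (α := F)
  have hw := hS.supportWeight_eq hh hG (Submodule.span F {a})
  rw [← hammingNorm_eq_supportWeight] at hw
  have hfr : finrank F (dotOrthogonal (Submodule.span F {a})) = k - 1 := by
    rw [finrank_dotOrthogonal, finrank_span_singleton ha0]
  have hk : 1 ≤ k := by
    have := hS.1
    have := finrank_le_of_submodule U₀
    omega
  have hV : finrank F (dotOrthogonal (Submodule.span F {a})) + 1 = finrank F (Fin k → F) := by
    rw [hfr, finrank_fin_fun]
    omega
  have hU : ∀ i, ¬ U i ≤ dotOrthogonal (Submodule.span F {a}) := fun i hi =>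
    ha (le_dotOrthogonal_span_singleton.1 ((hS.le hh i).trans hi))
  have hU₀ : ¬ U₀ ≤ dotOrthogonal (Submodule.span F {a}) := fun hi =>
    ha (le_dotOrthogonal_span_singleton.1 hi)
  simp only [finrank_hyperplane_inf hV, hU, hU₀, if_false, hS.1, hS.2.1, hfr] at hw
  generalize (Fintype.card F : ℤ) = q at hq hw ⊢
  refine mul_left_cancel₀ (show q - 1 ≠ 0 by linarith) ?_
  have hpu : ∀ i, q ^ u i = q * q ^ (u i - 1) := fun i =>
    pow_eq_mul_pow_pred (hu₀.trans (hlt i).le)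
  rw [hw, pow_eq_mul_pow_pred hk, pow_eq_mul_pow_pred hu₀]
  simp only [hpu, Finset.sum_sub_distrib, Finset.sum_const, Finset.card_univ, Fintype.card_fin,
    nsmul_eq_mul, ← Finset.mul_sum]
  ring

open Classical in
-- Here `a^⊥` contains the core, so only petals not contained in `a^⊥` lose a dimension, each
-- lowering the weight by `q ^ (u i - 1)`.
theorem IsSunflower.hammingNorm_of_mem [DecidableEq F] (hS : IsSunflower u₀ u U₀ U)
    (hh : 2 ≤ h) (hu₀ : 1 ≤ u₀) (hlt : ∀ i, u₀ < u i) (hG : IsComplementMatrix U G)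
    {a : Fin k → F} (ha0 : a ≠ 0) (ha : a ∈ dotOrthogonal U₀) :
    (hammingNorm (G.vecMulLinear a) : ℤ) = (Fintype.card F : ℤ) ^ (k - 1) -
      ∑ i with a ∉ dotOrthogonal (U i), (Fintype.card F : ℤ) ^ (u i - 1) := by
  have hq : (2 : ℤ) ≤ Fintype.card F := by exact_mod_cast Fintype.one_lt_card (α := F)
  have hw := hS.supportWeight_eq hh hG (Submodule.span F {a})
  rw [← hammingNorm_eq_supportWeight] at hw
  have hfr : finrank F (dotOrthogonal (Submodule.span F {a})) = k - 1 := by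
    rw [finrank_dotOrthogonal, finrank_span_singleton ha0]
  have hk : 1 ≤ k := by
    have := hS.1
    have := finrank_le_of_submodule U₀
    omega
  have hV : finrank F (dotOrthogonal (Submodule.span F {a})) + 1 = finrank F (Fin k → F) := by
    rw [hfr, finrank_fin_fun]
    omega
  simp only [finrank_hyperplane_inf hV, le_dotOrthogonal_span_singleton, ha, if_true, hS.1,
    hS.2.1, hfr] at hw
  generalize (Fintype.card F : ℤ) = q at hq hw ⊢
  refine mul_left_cancel₀ (show q - 1 ≠ 0 by linarith) ?_
  have hterm : ∀ i, q ^ (if a ∈ dotOrthogonal (U i) then u i else u i - 1) =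
      q ^ u i - (q - 1) * if a ∉ dotOrthogonal (U i) then q ^ (u i - 1) else 0 := by
    intro i
    split_ifs with h1
    · simp
    · rw [pow_eq_mul_pow_pred (hu₀.trans (hlt i).le)]
      ring
  rw [hw, Finset.sum_filter, pow_eq_mul_pow_pred hk]
  simp only [hterm, Finset.sum_sub_distrib, ← Finset.mul_sum]
  ring

end Weights

/-! ### Dimension, minimum distance and optimality. -/

section Parameters

theorem vecMulLinear_injective_of_pos {F : Type*} [Field F] [DecidableEq F] {k n : ℕ}
    {G : Matrix (Fin k) (Fin n) F}
    (hpos : ∀ a : Fin k → F, a ≠ 0 → 0 < hammingNorm (G.vecMulLinear a)) :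
    Function.Injective G.vecMulLinear := by
  rw [← LinearMap.ker_eq_bot, LinearMap.ker_eq_bot']
  intro a ha
  by_contra hne
  have := hpos a hne
  rw [ha, hammingNorm_zero] at this
  exact lt_irrefl _ this

variable {F : Type*} [Field F] [Fintype F] {k n h u₀ : ℕ} {u : Fin h → ℕ}

theorem add_le_of_sum_le (hlt : ∀ i, u₀ < u i) (hh : 1 ≤ h)
    (hk : ∑ i, u i ≤ k + (h - 1) * u₀) : u₀ + h ≤ k := by
  have h1 : ∑ _i : Fin h, (u₀ + 1) ≤ ∑ i, u i := Finset.sum_le_sum fun i _ => hlt i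
  rw [Finset.sum_const, Finset.card_univ, Fintype.card_fin, smul_eq_mul] at h1
  obtain ⟨g, rfl⟩ := Nat.exists_eq_add_of_le' hh
  rw [Nat.add_sub_cancel] at hk
  linarith

/-- The terms `h * q ^ u₀` subtracted in the size hypothesis are at most `q ^ (u₀ + 1) ≤ q ^ (k -
1)`. The conclusion makes the minimum distance positive. -/
theorem sum_pow_lt {q : ℕ} (hhq : h ≤ q) (hu₀k : u₀ + h ≤ k) (hh : 2 ≤ h)
    (hsize : (q : ℤ) ^ u₀ - 1 + ∑ i, ((q : ℤ) ^ u i - (q : ℤ) ^ u₀) <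
      (q : ℤ) ^ k - (q : ℤ) ^ (k - 1)) : ∑ i, (q : ℤ) ^ u i < (q : ℤ) ^ k := by
  rw [Finset.sum_sub_distrib, Finset.sum_const, Finset.card_univ, Fintype.card_fin,
    nsmul_eq_mul] at hsize
  have hq2 : (2 : ℤ) ≤ q := by exact_mod_cast hh.trans hhq
  have h1 : (q : ℤ) * (q : ℤ) ^ u₀ ≤ (q : ℤ) ^ (k - 1) := by
    rw [← pow_succ']
    exact pow_le_pow_right₀ (by linarith) (by omega)
  have h2 : (h : ℤ) * (q : ℤ) ^ u₀ ≤ q * (q : ℤ) ^ u₀ :=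
    mul_le_mul_of_nonneg_right (by exact_mod_cast hhq) (by positivity)
  have h3 : (1 : ℤ) ≤ (q : ℤ) ^ u₀ := one_le_pow₀ (by linarith)
  linarith

theorem sum_pow_pred_lt {q : ℕ} (hq : 2 ≤ q) (hu : ∀ i, 1 ≤ u i) (hk : 1 ≤ k)
    (hlt : ∑ i, (q : ℤ) ^ u i < (q : ℤ) ^ k) :
    ∑ i, (q : ℤ) ^ (u i - 1) < (q : ℤ) ^ (k - 1) := by
  refine lt_of_mul_lt_mul_left (a := (q : ℤ)) ?_ (by positivity)
  rw [← pow_eq_mul_pow_pred hk, Finset.mul_sum]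
  simpa only [← pow_eq_mul_pow_pred (hu _)] using hlt

variable {U₀ : Submodule F (Fin k → F)} {U : Fin h → Submodule F (Fin k → F)}
  {G : Matrix (Fin k) (Fin n) F}

/-- At most `q` proper subspaces do not cover: some functional kills `U₀` but no petal. -/
theorem IsSunflower.exists_mem_dotOrthogonal (hS : IsSunflower u₀ u U₀ U) (hh : 2 ≤ h)
    (hhq : h ≤ Fintype.card F) (hlt : ∀ i, u₀ < u i) (hu₀k : u₀ + h ≤ k) :
    ∃ a ∈ dotOrthogonal U₀, a ≠ 0 ∧ ∀ i, a ∉ dotOrthogonal (U i) := by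
  classical
  by_contra! hcon
  set q := Fintype.card F with hq
  have hq2 : 2 ≤ q := Fintype.one_lt_card
  -- Zero is removed before counting: with `h = q` the cardinalities including zero would not
  -- exclude a covering, while `q * (q ^ (k - u₀ - 1) - 1) < q ^ (k - u₀) - 1`.
  have hcard : ∀ A : Submodule F (Fin k → F),
      (((A : Set (Fin k → F)) \ (⊥ : Submodule F (Fin k → F))).toFinset).card =
        q ^ finrank F A - 1 := fun A => by
    rw [← Set.ncard_eq_toFinset_card', ncard_diff_submodule bot_le, finrank_bot, pow_zero]
  have hsub : ((dotOrthogonal U₀ : Set (Fin k → F)) \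
      (⊥ : Submodule F (Fin k → F))).toFinset ⊆ Finset.univ.biUnion fun i =>
        ((dotOrthogonal (U i) : Set (Fin k → F)) \ (⊥ : Submodule F (Fin k → F))).toFinset := by
    intro a ha
    simp only [Set.mem_toFinset, Set.mem_sdiff, SetLike.mem_coe, Submodule.mem_bot] at ha
    obtain ⟨i, hi⟩ := hcon a ha.1 ha.2
    simp only [Finset.mem_biUnion, Finset.mem_univ, true_and, Set.mem_toFinset, Set.mem_sdiff,
      SetLike.mem_coe, Submodule.mem_bot]
    exact ⟨i, hi, ha.2⟩
  have h1 := (Finset.card_le_card hsub).trans Finset.card_biUnion_le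
  simp only [hcard, finrank_dotOrthogonal, hS.1, hS.2.1] at h1
  have h2 : ∑ i, (q ^ (k - u i) - 1) ≤ ∑ _i : Fin h, (q ^ (k - u₀ - 1) - 1) :=
    Finset.sum_le_sum fun i _ => Nat.sub_le_sub_right
      (Nat.pow_le_pow_right (by omega) (by have := hlt i; omega)) 1
  rw [Finset.sum_const, Finset.card_univ, Fintype.card_fin, smul_eq_mul] at h2
  have h3 : q ^ (k - u₀) = q * q ^ (k - u₀ - 1) := by
    rw [← pow_succ']
    congr 1
    omega
  have h4 : 1 ≤ q ^ (k - u₀ - 1) := Nat.one_le_pow _ _ (by omega)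
  obtain ⟨p, hp⟩ := Nat.exists_eq_add_of_le' h4
  rw [h3, hp] at h1
  rw [hp, Nat.add_sub_cancel] at h2
  have h5 : h * p ≤ q * p := Nat.mul_le_mul_right p hhq
  have h6 : q * (p + 1) = q * p + q := by ring
  omega

variable [DecidableEq F]

theorem IsSunflower.le_hammingNorm (hS : IsSunflower u₀ u U₀ U)
    (hh : 2 ≤ h) (hu₀ : 1 ≤ u₀) (hlt : ∀ i, u₀ < u i) (hG : IsComplementMatrix U G)
    {a : Fin k → F} (ha0 : a ≠ 0) :
    (Fintype.card F : ℤ) ^ (k - 1) - ∑ i, (Fintype.card F : ℤ) ^ (u i - 1) ≤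
      hammingNorm (G.vecMulLinear a) := by
  classical
  by_cases ha : a ∈ dotOrthogonal U₀
  · rw [hS.hammingNorm_of_mem hh hu₀ hlt hG ha0 ha]
    exact sub_le_sub_left (Finset.sum_le_sum_of_subset_of_nonneg (Finset.filter_subset _ _)
      fun _ _ _ => by positivity) _
  · rw [hS.hammingNorm_of_notMem hh hu₀ hlt hG ha0 ha]
    have : (0 : ℤ) ≤ ((h : ℤ) - 1) * (Fintype.card F : ℤ) ^ (u₀ - 1) :=
      mul_nonneg (by have : (2 : ℤ) ≤ h := by exact_mod_cast hh
                     linarith) (by positivity)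
    linarith

theorem IsSunflower.isLinearCode (hS : IsSunflower u₀ u U₀ U)
    (hh : 2 ≤ h) (hhq : h ≤ Fintype.card F) (hu₀ : 1 ≤ u₀) (hlt : ∀ i, u₀ < u i)
    (hu₀k : u₀ + h ≤ k) (hG : IsComplementMatrix U G)
    (hinj : Function.Injective G.vecMulLinear) {d : ℕ}
    (hd : (d : ℤ) = (Fintype.card F : ℤ) ^ (k - 1) - ∑ i, (Fintype.card F : ℤ) ^ (u i - 1)) :
    IsLinearCode (rowCode G) k d := by
  classical
  refine ⟨?_, ?_, ?_⟩
  · rw [rowCode, LinearMap.finrank_range_of_inj hinj, finrank_fin_fun]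
  · obtain ⟨a, ha, ha0, haU⟩ := hS.exists_mem_dotOrthogonal hh hhq hlt hu₀k
    refine ⟨G.vecMulLinear a, ⟨a, rfl⟩, 0, zero_mem _, fun h => ha0 (hinj (by rw [h, map_zero])),
      ?_⟩
    have := hS.hammingNorm_of_mem hh hu₀ hlt hG ha0 ha
    rw [Finset.filter_true_of_mem fun i _ => haU i, ← hd] at this
    rw [hammingDist_zero_right]
    exact_mod_cast this
  · rintro w ⟨_, ⟨a, rfl⟩, _, ⟨b, rfl⟩, hab, rfl⟩
    have := hS.le_hammingNorm hh hu₀ hlt hG (a := a - b)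
      (sub_ne_zero.2 fun h => hab (by rw [h]))
    rw [hammingDist_comm, hammingDist_eq_hammingNorm, neg_add_eq_sub, ← map_sub]
    rw [← hd] at this
    exact_mod_cast this

/-- Optimality, from the Griesmer bound. -/
theorem IsSunflower.not_isLinearCode (hS : IsSunflower u₀ u U₀ U)
    (hh : 2 ≤ h) (hhq : h ≤ Fintype.card F) (hlt : ∀ i, u₀ < u i)
    (hG : IsComplementMatrix U G) {d m : ℕ}
    (hm : ∀ i, m ≤ u i) (hm1 : 1 ≤ m)
    (hdefect : ((h : ℤ) - 1) * ((Fintype.card F : ℤ) ^ u₀ - 1) < ((Fintype.card F : ℤ) - 1) * m)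
    (hd : (d : ℤ) = (Fintype.card F : ℤ) ^ (k - 1) - ∑ i, (Fintype.card F : ℤ) ^ (u i - 1)) :
    ¬ ∃ C' : Submodule F (Fin n → F), IsLinearCode C' k (d + 1) := by
  rintro ⟨C', hrank, hleast⟩
  have huk : ∀ i, u i ≤ k := fun i => hS.2.1 i ▸ finrank_le_of_submodule (U i)
  have hbound := sum_ceilDiv_le_card C' (d + 1) fun c hc hc0 => by
    have := hleast.2 ⟨c, hc, 0, zero_mem _, hc0, rfl⟩
    rwa [hammingDist_zero_right] at this
  rw [hrank, Fintype.card_fin] at hbound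
  have hq : 2 ≤ Fintype.card F := Fintype.one_lt_card
  have hlow := le_mul_sum_ceilDiv hq hhq (fun i => (Nat.zero_le _).trans_lt (hlt i)) huk hm hm1
    ((hm ⟨0, by omega⟩).trans (huk _)) hd
  have hlen := hS.length hh hG
  have hbound' : (∑ j ∈ Finset.range k, (((d + 1) ⌈/⌉ Fintype.card F ^ j : ℕ) : ℤ)) ≤ n := by
    exact_mod_cast hbound
  have := mul_le_mul_of_nonneg_left hbound'
    (by linarith [show (2 : ℤ) ≤ Fintype.card F by exact_mod_cast hq] :
      (0 : ℤ) ≤ (Fintype.card F : ℤ) - 1)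
  rw [hlen] at this
  simp only [Finset.sum_sub_distrib, Finset.sum_const, Finset.card_univ, Fintype.card_fin,
    nsmul_eq_mul, mul_one] at this hlow
  linarith

end Parameters

/-! ### Existence of the construction -/

section Existence

variable {F : Type*} [Field F] {k h : ℕ}

/-- The vectors supported in `S`. -/
noncomputable def coordSubspace (F : Type*) [Field F] {k : ℕ} (S : Set (Fin k)) :
    Submodule F (Fin k → F) :=
  (Finsupp.supported F F S).map (Finsupp.linearEquivFunOnFinite F F (Fin k)).toLinearMap

theorem finrank_coordSubspace (S : Set (Fin k)) : finrank F (coordSubspace F S) = S.ncard := by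
  classical
  rw [coordSubspace, LinearEquiv.finrank_map_eq,
    (Finsupp.supportedEquivFinsupp S).finrank_eq, finrank_finsupp_self,
    ← Nat.card_eq_fintype_card, Nat.card_coe_set_eq]

theorem coordSubspace_inter (S T : Set (Fin k)) :
    coordSubspace F (S ∩ T) = coordSubspace F S ⊓ coordSubspace F T := by
  rw [coordSubspace, Finsupp.supported_inter, Submodule.map_inf _ (LinearEquiv.injective _)]
  rfl

theorem coordSubspace_iUnion {ι : Type*} (S : ι → Set (Fin k)) :
    coordSubspace F (⋃ i, S i) = ⨆ i, coordSubspace F (S i) := by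
  rw [coordSubspace, Finsupp.supported_iUnion, Submodule.map_iSup]
  rfl

theorem sum_sub_add_mul {u₀ : ℕ} {u : Fin h → ℕ} (hlt : ∀ i, u₀ < u i) :
    ∑ i, (u i - u₀) + h * u₀ = ∑ i, u i := by
  have : ∑ i, (u i - u₀ + u₀) = ∑ i, u i :=
    Finset.sum_congr rfl fun i _ => Nat.sub_add_cancel (hlt i).le
  rw [← this, Finset.sum_add_distrib, Finset.sum_const, Finset.card_univ, Fintype.card_fin,
    smul_eq_mul]

theorem exists_isSunflower {u₀ : ℕ} {u : Fin h → ℕ} (hh : 2 ≤ h) (hlt : ∀ i, u₀ < u i)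
    (hk : ∑ i, u i ≤ k + (h - 1) * u₀) :
    ∃ (U₀ : Submodule F (Fin k → F)) (U : Fin h → Submodule F (Fin k → F)),
      IsSunflower u₀ u U₀ U ∧ finrank F ↥(⨆ i, U i) + (h - 1) * u₀ = ∑ i, u i := by
  have hsum := sum_sub_add_mul hlt
  have hmul : h * u₀ = (h - 1) * u₀ + u₀ := by
    obtain ⟨g, rfl⟩ := Nat.exists_eq_add_of_le' (show 1 ≤ h by omega)
    rw [Nat.add_sub_cancel]
    ring
  -- Coordinate subspaces suffice: `u₀` shared coordinates and disjoint blocks of `u i - u₀` further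
  -- ones. They fit into `k` coordinates precisely by `hk`.
  obtain ⟨e⟩ : Nonempty (Fin u₀ ⊕ (Σ i : Fin h, Fin (u i - u₀)) ↪ Fin k) := by
    refine Function.Embedding.nonempty_of_card_le ?_
    simp only [Fintype.card_sum, Fintype.card_fin, Fintype.card_sigma]
    omega
  let T₀ : Set (Fin u₀ ⊕ (Σ i : Fin h, Fin (u i - u₀))) := Set.range Sum.inl
  let T : Fin h → Set (Fin u₀ ⊕ (Σ i : Fin h, Fin (u i - u₀))) := fun i =>
    Set.range (Sum.elim Sum.inl fun x => Sum.inr ⟨i, x⟩ : Fin u₀ ⊕ Fin (u i - u₀) → _)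
  have hT₀ : T₀.ncard = u₀ := by
    simp only [T₀]
    rw [← Set.image_univ, Set.ncard_image_of_injective _ Sum.inl_injective, Set.ncard_univ,
      Nat.card_fin]
  have hT : ∀ i, (T i).ncard = u i := fun i => by
    have hinj : Function.Injective
        (Sum.elim Sum.inl fun x => Sum.inr ⟨i, x⟩ : Fin u₀ ⊕ Fin (u i - u₀) →
          Fin u₀ ⊕ (Σ i : Fin h, Fin (u i - u₀))) := by
      rintro (x | x) (y | y) <;> simp
    simp only [T]
    rw [← Set.image_univ, Set.ncard_image_of_injective _ hinj, Set.ncard_univ]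
    have := hlt i
    simp only [Nat.card_eq_fintype_card, Fintype.card_sum, Fintype.card_fin]
    omega
  have hTT : ∀ i j, i ≠ j → T i ∩ T j = T₀ := by
    intro i j hij
    ext (x | ⟨l, x⟩)
    · simp [T, T₀]
    · simp only [T, T₀, Set.mem_inter_iff, Set.mem_range, Sum.exists, Sum.elim_inl, reduceCtorEq,
        exists_false, Sum.elim_inr, Sum.inr.injEq, Sigma.mk.injEq, false_or, iff_false, not_and]
      rintro ⟨_, rfl, -⟩ ⟨_, rfl, -⟩
      exact hij rfl
  have hTU : ⋃ i, T i = Set.univ := by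
    refine Set.eq_univ_of_forall ?_
    rintro (x | ⟨l, x⟩)
    · exact Set.mem_iUnion.2 ⟨⟨0, by omega⟩, Sum.inl x, rfl⟩
    · exact Set.mem_iUnion.2 ⟨l, Sum.inr x, rfl⟩
  refine ⟨coordSubspace F (e '' T₀), fun i => coordSubspace F (e '' T i), ⟨?_, ?_, ?_⟩, ?_⟩
  · rw [finrank_coordSubspace, Set.ncard_image_of_injective _ e.injective, hT₀]
  · intro i
    rw [finrank_coordSubspace, Set.ncard_image_of_injective _ e.injective, hT]
  · intro i j hij
    rw [← coordSubspace_inter, ← Set.image_inter e.injective, hTT i j hij]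
  · rw [← coordSubspace_iUnion, ← Set.image_iUnion, hTU, finrank_coordSubspace,
      Set.ncard_image_of_injective _ e.injective, Set.ncard_univ]
    simp only [Nat.card_eq_fintype_card, Fintype.card_sum, Fintype.card_fin, Fintype.card_sigma]
    omega

theorem exists_isComplementMatrix [Finite F] (U : Fin h → Submodule F (Fin k → F)) :
    ∃ (n : ℕ) (G : Matrix (Fin k) (Fin n) F), IsComplementMatrix U G := by
  classical
  let X := {p : Projectivization F (Fin k → F) // ∀ i, p.rep ∉ U i}
  have : Finite X := inferInstance
  let e : X ≃ Fin (Nat.card X) := Finite.equivFin X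
  refine ⟨Nat.card X, Matrix.of fun x j => (e.symm j).1.rep x, ?_, ?_⟩
  · exact fun j => ⟨(e.symm j).1.rep_nonzero, (e.symm j).2⟩
  · have hcol : ∀ p : X, (Matrix.of fun x j => (e.symm j).1.rep x).col (e p) = p.1.rep :=
      fun p => by
        ext x
        simp [Matrix.col]
    intro v hv hU
    obtain ⟨a, ha⟩ := Projectivization.exists_smul_eq_mk_rep F v hv
    have hv' : v = (a⁻¹ : Fˣ) • (Projectivization.mk F v hv).rep := by rw [← ha, inv_smul_smul]
    refine ⟨e ⟨Projectivization.mk F v hv, fun i hi => hU i ?_⟩,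
      ⟨(a⁻¹ : Fˣ), Units.ne_zero _, ?_⟩, ?_⟩
    · rw [hv']
      exact (U i).smul_mem _ hi
    · rw [hcol]
      exact hv'
    · rintro j ⟨c, hc, hj⟩
      rw [← e.symm_apply_eq]
      refine Subtype.ext ?_
      rw [← Projectivization.mk_rep (e.symm j).1]
      refine (Projectivization.mk_eq_mk_iff' F _ _ _ _).2 ⟨c⁻¹, ?_⟩
      rw [hj, inv_smul_smul₀ hc]
      rfl

end Existence

/-! ### Membership patterns for subspaces in general position. -/

section Pattern

variable {F E : Type*} [Field F] [Fintype F] [AddCommGroup E] [Module F E] [Finite E]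

theorem ncard_fiber_eq {E' : Type*} [AddCommGroup E'] [Module F E'] (f : E →ₗ[F] E') (x : E) :
    {a | f a = f x}.ncard = Fintype.card F ^ finrank F (LinearMap.ker f) := by
  rw [← ncard_submodule,
    ← Set.ncard_image_of_injective (LinearMap.ker f : Set E) (add_right_injective x)]
  congr 1
  ext a
  constructor
  · intro ha
    refine ⟨a - x, ?_, add_sub_cancel x a⟩
    have ha : f a = f x := ha
    simp [ha]
  · rintro ⟨b, hb, rfl⟩
    have hb : f b = 0 := hb
    simp [hb]

/-- For subspaces `N i` in general position, the number of vectors that lie outside `N i`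
exactly for `i ∈ S`. -/
theorem ncard_forall_mem_iff_notMem {ι : Type*} [Fintype ι] [DecidableEq ι] (N : ι → Submodule F E)
    (hN : finrank F ↥(⨅ i, N i) + ∑ i, finrank F (E ⧸ N i) = finrank F E) (S : Finset ι) :
    {a : E | ∀ i, i ∈ S ↔ a ∉ N i}.ncard =
      (∏ i ∈ S, (Fintype.card F ^ finrank F (E ⧸ N i) - 1)) *
        Fintype.card F ^ finrank F ↥(⨅ i, N i) := by
  classical
  let f : E →ₗ[F] (∀ i, E ⧸ N i) := LinearMap.pi fun i => (N i).mkQ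
  have hker : LinearMap.ker f = ⨅ i, N i := by
    simp [f, LinearMap.ker_pi]
  -- General position is used only here: by rank-nullity, `hN` says that the map to the product of
  -- the quotients is onto, so the conditions for different `i` are independent.
  have hsurj : Function.Surjective f := by
    rw [← LinearMap.range_eq_top]
    apply Submodule.eq_top_of_finrank_eq
    have := LinearMap.finrank_range_add_finrank_ker f
    rw [hker] at this
    rw [finrank_pi_fintype]
    omega
  have hfin : ∀ i, Finite (E ⧸ N i) := fun i =>
    Finite.of_surjective _ (N i).mkQ_surjective
  have : ∀ i, Fintype (E ⧸ N i) := fun i => Fintype.ofFinite _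
  rw [ncard_eq_mul_of_fiber f (Fintype.card F ^ finrank F ↥(⨅ i, N i))
    (T := {b : ∀ i, E ⧸ N i | ∀ i, i ∈ S ↔ b i ≠ 0})]
  · congr 1
    have hT : {b : ∀ i, E ⧸ N i | ∀ i, i ∈ S ↔ b i ≠ 0} =
        ↑(Fintype.piFinset fun i : ι =>
          if i ∈ S then (Finset.univ.erase 0 : Finset (E ⧸ N i)) else {0}) := by
      ext b
      simp only [Set.mem_ofPred_eq, Finset.mem_coe, Fintype.mem_piFinset]
      refine forall_congr' fun i => ?_
      by_cases hi : i ∈ S <;> simp [hi]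
    rw [hT, Set.ncard_coe_finset, Fintype.card_piFinset]
    have hc : ∀ i, (if i ∈ S then (Finset.univ.erase 0 : Finset (E ⧸ N i)) else {0}).card =
        if i ∈ S then Fintype.card F ^ finrank F (E ⧸ N i) - 1 else 1 := fun i => by
      split_ifs
      · rw [Finset.card_erase_of_mem (Finset.mem_univ _), Finset.card_univ,
          Module.card_eq_pow_finrank (K := F)]
      · simp
    rw [Finset.prod_congr rfl fun i _ => hc i, Finset.prod_ite_mem, Finset.univ_inter]
  · intro a ha i
    refine (ha i).trans (not_congr ?_)
    exact (Submodule.Quotient.mk_eq_zero _).symm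
  · intro b hb
    obtain ⟨x, rfl⟩ := hsurj b
    rw [← hker, ← ncard_fiber_eq f x]
    congr 1
    ext a
    simp only [Set.mem_ofPred_eq, and_iff_right_iff_imp]
    intro hax i
    refine (hb i).trans (not_congr ?_)
    rw [← hax]
    exact Submodule.Quotient.mk_eq_zero _

end Pattern

/-! ### The weight distribution. -/

section WeightDistribution

variable {F : Type*} [Field F] [Fintype F] {k n h u₀ : ℕ} {u : Fin h → ℕ}
  {U₀ : Submodule F (Fin k → F)} {U : Fin h → Submodule F (Fin k → F)}
  {G : Matrix (Fin k) (Fin n) F}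

theorem IsSunflower.ncard_pattern (hS : IsSunflower u₀ u U₀ U) (hh : 2 ≤ h)
    (hlt : ∀ i, u₀ < u i)
    (hdim : finrank F ↥(⨆ i, U i) + (h - 1) * u₀ = ∑ i, u i) (S : Finset (Fin h)) :
    {a | a ∈ dotOrthogonal U₀ ∧ ∀ i, i ∈ S ↔ a ∉ dotOrthogonal (U i)}.ncard =
      (∏ i ∈ S, (Fintype.card F ^ (u i - u₀) - 1)) *
        Fintype.card F ^ (k + (h - 1) * u₀ - ∑ i, u i) := by
  let N : Fin h → Submodule F (dotOrthogonal U₀) := fun i =>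
    (dotOrthogonal (U i)).submoduleOf (dotOrthogonal U₀)
  have hle : ∀ i, dotOrthogonal (U i) ≤ dotOrthogonal U₀ := fun i =>
    LinearMap.BilinForm.orthogonal_le (hS.le hh i)
  have hN : ∀ i, finrank F (N i) = k - u i := fun i => by
    rw [(Submodule.submoduleOfEquivOfLe (hle i)).finrank_eq, finrank_dotOrthogonal, hS.2.1]
  have hE : finrank F (dotOrthogonal U₀) = k - u₀ := by rw [finrank_dotOrthogonal, hS.1]
  have huk : ∀ i, u i ≤ k := fun i => hS.2.1 i ▸ finrank_le_of_submodule (U i)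
  have hQ : ∀ i, finrank F (dotOrthogonal U₀ ⧸ N i) = u i - u₀ := fun i => by
    have := (N i).finrank_quotient_add_finrank
    rw [hN, hE] at this
    have := huk i
    have := hlt i
    omega
  have hinf : finrank F ↥(⨅ i, N i) = k - finrank F ↥(⨆ i, U i) := by
    rw [← finrank_dotOrthogonal]
    have hsup : dotOrthogonal (⨆ i, U i) ≤ dotOrthogonal U₀ :=
      LinearMap.BilinForm.orthogonal_le ((hS.le hh ⟨0, by omega⟩).trans (le_iSup U _))
    rw [← (Submodule.submoduleOfEquivOfLe hsup).finrank_eq]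
    suffices h : ⨅ i, N i = (dotOrthogonal (⨆ i, U i)).submoduleOf (dotOrthogonal U₀) by rw [h]
    ext ⟨a, ha⟩
    have key : a ∈ dotOrthogonal (⨆ i, U i) ↔ ∀ i, a ∈ dotOrthogonal (U i) := by
      simp only [← Submodule.span_singleton_le_iff_mem, le_dotOrthogonal_comm (B := ⨆ i, U i),
        le_dotOrthogonal_comm (B := U _), iSup_le_iff]
    simpa [N, Submodule.submoduleOf] using key.symm
  have hsupk := finrank_le_of_submodule (⨆ i, U i)
  have hs := sum_sub_add_mul hlt
  have hmul : h * u₀ = (h - 1) * u₀ + u₀ := by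
    obtain ⟨g, rfl⟩ := Nat.exists_eq_add_of_le' (show 1 ≤ h by omega)
    rw [Nat.add_sub_cancel]
    ring
  have := ncard_forall_mem_iff_notMem N (by
    rw [hinf, hE, Finset.sum_congr rfl fun i _ => hQ i]
    omega) S
  rw [hinf, Finset.prod_congr rfl fun i _ => by rw [hQ i]] at this
  rw [show k + (h - 1) * u₀ - ∑ i, u i = k - finrank F ↥(⨆ i, U i) by omega, ← this,
    ← Set.ncard_image_of_injective _ Subtype.val_injective]
  congr 1
  ext a
  constructor
  · rintro ⟨ha, hi⟩
    exact ⟨⟨a, ha⟩, hi, rfl⟩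
  · rintro ⟨⟨a, ha⟩, hi, rfl⟩
    exact ⟨ha, hi⟩

theorem weightCount_eq_sum [DecidableEq F] (hinj : Function.Injective G.vecMulLinear) (w : ℕ) :
    (weightCount (rowCode G) w : ℤ) =
      ∑ a : Fin k → F, if hammingNorm (G.vecMulLinear a) = w then 1 else 0 := by
  rw [Finset.sum_boole, ← Set.ncard_coe_finset, ← Set.ncard_image_of_injective _ hinj,
    weightCount]
  congr 2
  ext c
  constructor
  · rintro ⟨⟨a, rfl⟩, hw⟩
    exact ⟨a, Finset.mem_coe.2 (Finset.mem_filter.2 ⟨Finset.mem_univ _, hw⟩), rfl⟩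
  · rintro ⟨a, ha, rfl⟩
    exact ⟨⟨a, rfl⟩, (Finset.mem_filter.1 (Finset.mem_coe.1 ha)).2⟩

theorem IsSunflower.weightCount_eq [DecidableEq F] (hS : IsSunflower u₀ u U₀ U)
    (hh : 2 ≤ h) (hu₀ : 1 ≤ u₀) (hlt : ∀ i, u₀ < u i) (hG : IsComplementMatrix U G)
    (hinj : Function.Injective G.vecMulLinear)
    (hdim : finrank F ↥(⨆ i, U i) + (h - 1) * u₀ = ∑ i, u i) (w : ℕ) :
    (weightCount (rowCode G) w : ℤ) =
      (if w = 0 then 1 else 0)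
      + (if (w : ℤ) = (Fintype.card F : ℤ) ^ (k - 1)
            + ((h : ℤ) - 1) * (Fintype.card F : ℤ) ^ (u₀ - 1)
            - ∑ i, (Fintype.card F : ℤ) ^ (u i - 1)
          then ((Fintype.card F : ℤ) ^ u₀ - 1) * (Fintype.card F : ℤ) ^ (k - u₀) else 0)
      + (∑ S : Finset (Fin h),
          if S.Nonempty ∧ (w : ℤ) = (Fintype.card F : ℤ) ^ (k - 1)
              - ∑ i ∈ S, (Fintype.card F : ℤ) ^ (u i - 1)
          then (∏ i ∈ S, ((Fintype.card F : ℤ) ^ (u i - u₀) - 1)) *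
            (Fintype.card F : ℤ) ^ (k + (h - 1) * u₀ - ∑ i, u i) else 0)
      + (if (w : ℤ) = (Fintype.card F : ℤ) ^ (k - 1)
          then (Fintype.card F : ℤ) ^ (k + (h - 1) * u₀ - ∑ i, u i) - 1 else 0) := by
  classical
  have hq : 1 ≤ Fintype.card F := Fintype.card_pos
  rw [weightCount_eq_sum hinj]
  set q : ℤ := (Fintype.card F : ℤ) with hqdef
  set W₀ : ℤ := q ^ (k - 1) + ((h : ℤ) - 1) * q ^ (u₀ - 1) - ∑ i, q ^ (u i - 1) with hW₀
  let W : Finset (Fin h) → ℤ := fun S => q ^ (k - 1) - ∑ i ∈ S, q ^ (u i - 1)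
  let pat : (Fin k → F) → Finset (Fin h) := fun a =>
    Finset.univ.filter fun i => a ∉ dotOrthogonal (U i)
  -- The zero vector has the empty pattern, so the sum over `S` assigns it weight `q ^ (k - 1)`; the
  -- first summand moves it to weight `0`. This is the origin of the `- 1` in the last multiplicity.
  have hterm : ∀ a : Fin k → F,
      (if hammingNorm (G.vecMulLinear a) = w then (1 : ℤ) else 0) =
        (if a = 0 then (if w = 0 then 1 else 0) - (if (w : ℤ) = q ^ (k - 1) then 1 else 0)
          else 0) +
        (if a ∉ dotOrthogonal U₀ then (if (w : ℤ) = W₀ then 1 else 0) else 0) +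
        ∑ S : Finset (Fin h), (if a ∈ dotOrthogonal U₀ ∧ ∀ i, i ∈ S ↔ a ∉ dotOrthogonal (U i)
          then (if (w : ℤ) = W S then 1 else 0) else 0) := by
    intro a
    have hpat : ∀ S : Finset (Fin h),
        (∀ i, i ∈ S ↔ a ∉ dotOrthogonal (U i)) ↔ S = pat a := fun S => by
      simp [Finset.ext_iff, pat]
    simp only [hpat]
    by_cases ha0 : a = 0
    · have hp : pat 0 = ∅ := by simp [pat, zero_mem]
      subst ha0
      simp [zero_mem, hp, W, eq_comm]
    · by_cases ha : a ∈ dotOrthogonal U₀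
      · have hw := hS.hammingNorm_of_mem hh hu₀ hlt hG ha0 ha
        have hiff : hammingNorm (G.vecMulLinear a) = w ↔ (w : ℤ) = W (pat a) := by
          rw [← Nat.cast_inj (R := ℤ), hw, eq_comm]
        simp only [hiff]
        simp [ha0, ha]
      · have hw := hS.hammingNorm_of_notMem hh hu₀ hlt hG ha0 ha
        have hiff : hammingNorm (G.vecMulLinear a) = w ↔ (w : ℤ) = W₀ := by
          rw [← Nat.cast_inj (R := ℤ), hw, eq_comm]
        simp only [hiff]
        simp [ha0, ha]
  have hcount : ∀ (p : (Fin k → F) → Prop) [DecidablePred p] (c : ℤ),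
      ∑ a, (if p a then c else 0) = ({a | p a}.ncard : ℤ) * c := by
    intro p _ c
    rw [← Finset.sum_filter, Finset.sum_const, nsmul_eq_mul, ← Set.ncard_coe_finset]
    simp
  have hu0k : u₀ ≤ k := hS.1 ▸ finrank_le_of_submodule U₀
  have hcompl : ({a | a ∉ dotOrthogonal U₀}.ncard : ℤ) = (q ^ u₀ - 1) * q ^ (k - u₀) := by
    have h1 : {a | a ∉ dotOrthogonal U₀} =
        ((⊤ : Submodule F (Fin k → F)) : Set (Fin k → F)) \ dotOrthogonal U₀ := by
      ext a
      simp
    rw [h1, ncard_diff_submodule le_top, finrank_top, finrank_fin_fun, finrank_dotOrthogonal,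
      hS.1, Nat.cast_sub (Nat.pow_le_pow_right hq (by omega)), sub_mul, ← pow_add,
      Nat.add_sub_cancel' hu0k]
    push_cast
    ring
  rw [Finset.sum_congr rfl fun a _ => hterm a, Finset.sum_add_distrib, Finset.sum_add_distrib,
    Finset.sum_comm (s := (Finset.univ : Finset (Fin k → F))), hcount, hcount, hcompl,
    Finset.sum_congr rfl fun S _ => hcount _ _,
    Finset.sum_congr rfl fun S _ => by rw [hS.ncard_pattern hh hlt hdim S]]
  have hprod : ∀ S : Finset (Fin h),
      (((∏ i ∈ S, (Fintype.card F ^ (u i - u₀) - 1)) *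
        Fintype.card F ^ (k + (h - 1) * u₀ - ∑ i, u i) : ℕ) : ℤ) =
      (∏ i ∈ S, (q ^ (u i - u₀) - 1)) * q ^ (k + (h - 1) * u₀ - ∑ i, u i) := fun S => by
    rw [Nat.cast_mul, Nat.cast_prod, Nat.cast_pow]
    congr 1
    refine Finset.prod_congr rfl fun i _ => ?_
    rw [Nat.cast_sub (Nat.one_le_pow _ _ hq)]
    push_cast
    rfl
  simp only [hprod]
  have h0 : {a : Fin k → F | a = 0}.ncard = 1 := by simp
  rw [h0, ← Finset.add_sum_erase _ _ (Finset.mem_univ (∅ : Finset (Fin h))),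
    ← Finset.add_sum_erase _ (fun S : Finset (Fin h) => ite _ _ _)
      (Finset.mem_univ (∅ : Finset (Fin h)))]
  have hne : ∀ S ∈ (Finset.univ : Finset (Finset (Fin h))).erase ∅,
      (if S.Nonempty ∧ (w : ℤ) = q ^ (k - 1) - ∑ i ∈ S, q ^ (u i - 1)
        then (∏ i ∈ S, (q ^ (u i - u₀) - 1)) * q ^ (k + (h - 1) * u₀ - ∑ i, u i) else 0) =
      (∏ i ∈ S, (q ^ (u i - u₀) - 1)) * q ^ (k + (h - 1) * u₀ - ∑ i, u i) *
        (if (w : ℤ) = W S then 1 else 0) := fun S hSm => by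
    have : S.Nonempty := Finset.nonempty_iff_ne_empty.2 (Finset.ne_of_mem_erase hSm)
    simp [this, W]
  rw [Finset.sum_congr rfl hne]
  have hW : W ∅ = q ^ (k - 1) := by simp [W]
  simp only [hW, Finset.not_nonempty_empty, false_and, if_false, Finset.prod_empty]
  split_ifs <;> push_cast <;> ring

end WeightDistribution

/-! ### Two petals: generalized Hamming weights and support weight distribution. -/

theorem countSum_nonneg {q : ℕ} (hq : 2 ≤ q) (t u₀ u₁ u₂ v₀ v₁ v₂ : ℕ) :
    0 ≤ countSum q t u₀ u₁ u₂ v₀ v₁ v₂ := by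
  have := (prod_pow_sub_pow_pos hq (le_refl t)).le
  unfold countSum countDirect
  have hg : ∀ m r, 0 ≤ gaussian q m r := fun m r => gaussian_nonneg hq
  have h1 := hg u₀ v₀
  have h2 := hg (u₁ - u₀ - (v₁ - v₀)) t
  have h3 := hg (u₂ - u₀ - (v₂ - v₀)) t
  have h4 := hg (u₁ - u₀) (v₁ - v₀)
  have h5 := hg (u₂ - u₀) (v₂ - v₀)
  positivity

/-- All summands are nonnegative, so one admissible `t` is enough. Used to prove that subspaces
exist without constructing them. -/
theorem countSubspaces_pos {q k u₀ u₁ u₂ l v₀ v₁ v₂ : ℕ} (hq : 2 ≤ q) (t : ℕ)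
    (hs : t + v₁ + v₂ ≤ l + v₀) (hl : l + v₀ - (t + v₁ + v₂) ≤ k + u₀ - (u₁ + u₂))
    (h₀ : v₀ ≤ u₀) (h₁ : t + (v₁ - v₀) ≤ u₁ - u₀) (h₂ : t + (v₂ - v₀) ≤ u₂ - u₀)
    (ht₁ : t + v₁ ≤ u₁) (ht₂ : t + v₂ ≤ u₂) :
    0 < countSubspaces q k u₀ u₁ u₂ l v₀ v₁ v₂ := by
  have hq0 : (0 : ℚ) < q := by positivity
  unfold countSubspaces
  refine Finset.sum_pos' (fun i _ => ?_) ⟨t, Finset.mem_range.2 (by omega), ?_⟩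
  · split_ifs
    · exact mul_nonneg (mul_nonneg (by positivity) (gaussian_nonneg hq))
        (countSum_nonneg hq ..)
    · exact le_rfl
  · rw [if_pos hs]
    have g1 := prod_pow_sub_pow_pos hq (le_refl t)
    have g2 := gaussian_pos hq hl
    have g3 := gaussian_pos hq h₀
    have g4 := gaussian_pos hq (show t ≤ u₁ - u₀ - (v₁ - v₀) by omega)
    have g5 := gaussian_pos hq (show t ≤ u₂ - u₀ - (v₂ - v₀) by omega)
    have g6 := gaussian_pos hq (show v₁ - v₀ ≤ u₁ - u₀ by omega)
    have g7 := gaussian_pos hq (show v₂ - v₀ ≤ u₂ - u₀ by omega)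
    unfold countSum countDirect
    positivity

section TwoPetals

variable {F : Type*} [Field F] {k n u₀ : ℕ} {u : Fin 2 → ℕ}
  {U₀ : Submodule F (Fin k → F)} {U : Fin 2 → Submodule F (Fin k → F)}
  {G : Matrix (Fin k) (Fin n) F}

theorem IsSunflower.inf_eq (hS : IsSunflower u₀ u U₀ U) : U 0 ⊓ U 1 = U₀ :=
  hS.2.2 0 1 (by decide)

/-- The constraints on the intersection dimensions of a subspace with a two-petal sunflower. -/
theorem IsSunflower.finrank_bounds (hS : IsSunflower u₀ u U₀ U) (V : Submodule F (Fin k → F)) :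
    (u₀ + finrank F V ≤ k + finrank F ↥(V ⊓ U₀) ∧ u 0 + finrank F V ≤ k + finrank F ↥(V ⊓ U 0) ∧
      u 1 + finrank F V ≤ k + finrank F ↥(V ⊓ U 1)) ∧
    (finrank F ↥(V ⊓ U₀) ≤ u₀ ∧ finrank F ↥(V ⊓ U 0) ≤ u 0 ∧ finrank F ↥(V ⊓ U 1) ≤ u 1) ∧
    (finrank F ↥(V ⊓ U₀) ≤ finrank F ↥(V ⊓ U 0) ∧
      finrank F ↥(V ⊓ U₀) ≤ finrank F ↥(V ⊓ U 1)) ∧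
    (finrank F ↥(V ⊓ U 0) + u₀ ≤ u 0 + finrank F ↥(V ⊓ U₀) ∧
      finrank F ↥(V ⊓ U 1) + u₀ ≤ u 1 + finrank F ↥(V ⊓ U₀)) ∧
    finrank F ↥(V ⊓ U 0) + finrank F ↥(V ⊓ U 1) ≤ finrank F V + finrank F ↥(V ⊓ U₀) := by
  have h0 := hS.le le_rfl 0
  have h1 := hS.le le_rfl 1
  have hcodim : ∀ W : Submodule F (Fin k → F),
      finrank F W + finrank F V ≤ k + finrank F ↥(V ⊓ W) := fun W => by
    have e1 := Submodule.finrank_sup_add_finrank_inf_eq V W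
    have e2 := finrank_le_of_submodule (V ⊔ W)
    omega
  have hpetal : ∀ i, finrank F ↥(V ⊓ U i) + u₀ ≤ u i + finrank F ↥(V ⊓ U₀) := fun i => by
    have hi := hS.le le_rfl i
    have e1 := Submodule.finrank_sup_add_finrank_inf_eq (V ⊓ U i) U₀
    rw [inf_assoc, inf_eq_right.2 hi, hS.1] at e1
    have e2 := Submodule.finrank_mono (R := F) (sup_le inf_le_right hi : V ⊓ U i ⊔ U₀ ≤ U i)
    rw [hS.2.1] at e2
    omega
  have hsum := Submodule.finrank_sup_add_finrank_inf_eq (V ⊓ U 0) (V ⊓ U 1)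
  rw [← inf_inf_distrib_left, hS.inf_eq] at hsum
  have hV := Submodule.finrank_mono (R := F)
    (sup_le inf_le_left inf_le_left : V ⊓ U 0 ⊔ V ⊓ U 1 ≤ V)
  refine ⟨⟨hS.1 ▸ hcodim U₀, hS.2.1 0 ▸ hcodim (U 0), hS.2.1 1 ▸ hcodim (U 1)⟩,
    ⟨?_, ?_, ?_⟩, ⟨?_, ?_⟩, ⟨hpetal 0, hpetal 1⟩, by omega⟩
  · exact hS.1 ▸ Submodule.finrank_mono inf_le_right
  · exact hS.2.1 0 ▸ Submodule.finrank_mono inf_le_right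
  · exact hS.2.1 1 ▸ Submodule.finrank_mono inf_le_right
  · exact Submodule.finrank_mono (inf_le_inf_left V h0)
  · exact Submodule.finrank_mono (inf_le_inf_left V h1)

/-- The subcode whose coefficient vectors are orthogonal to `V`. -/
noncomputable def subcodeOf (G : Matrix (Fin k) (Fin n) F) (V : Submodule F (Fin k → F)) :
    Submodule F (Fin n → F) :=
  (dotOrthogonal V).map G.vecMulLinear

theorem subcodeOf_injective (hinj : Function.Injective G.vecMulLinear) :
    Function.Injective (subcodeOf G) := fun V W h => by
  rw [← dotOrthogonal_dotOrthogonal V, ← dotOrthogonal_dotOrthogonal W,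
    Submodule.map_injective_of_injective hinj h]

theorem exists_subcodeOf_iff (hinj : Function.Injective G.vecMulLinear) {r : ℕ} (hr : r ≤ k)
    (D : Submodule F (Fin n → F)) :
    (D ≤ rowCode G ∧ finrank F D = r) ↔
      ∃ V : Submodule F (Fin k → F), finrank F V = k - r ∧ subcodeOf G V = D := by
  constructor
  · rintro ⟨hD, hr'⟩
    have hmap : (D.comap G.vecMulLinear).map G.vecMulLinear = D := by
      rw [Submodule.map_comap_eq, inf_eq_right]
      exact hD
    refine ⟨dotOrthogonal (D.comap G.vecMulLinear), ?_, ?_⟩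
    · rw [finrank_dotOrthogonal, (Submodule.equivMapOfInjective _ hinj _).finrank_eq, hmap, hr']
    · rw [subcodeOf, dotOrthogonal_dotOrthogonal, hmap]
  · rintro ⟨V, hV, rfl⟩
    refine ⟨LinearMap.map_le_range, ?_⟩
    rw [subcodeOf, ← (Submodule.equivMapOfInjective _ hinj _).finrank_eq, finrank_dotOrthogonal, hV]
    omega

theorem subcodeCount_rowCode (hinj : Function.Injective G.vecMulLinear) {r : ℕ}
    (hr : r ≤ k) (j : ℕ) :
    subcodeCount (rowCode G) r j =
      {V : Submodule F (Fin k → F) |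
        finrank F V = k - r ∧ supportWeight (subcodeOf G V) = j}.ncard := by
  rw [subcodeCount, ← Set.ncard_image_of_injective
    {V : Submodule F (Fin k → F) | finrank F V = k - r ∧ supportWeight (subcodeOf G V) = j}
    (subcodeOf_injective hinj)]
  congr 1
  ext D
  constructor
  · rintro ⟨hD, hr', hj⟩
    obtain ⟨V, hV, rfl⟩ := (exists_subcodeOf_iff hinj hr D).1 ⟨hD, hr'⟩
    exact ⟨V, ⟨hV, hj⟩, rfl⟩
  · rintro ⟨V, ⟨hV, hj⟩, rfl⟩
    have := (exists_subcodeOf_iff hinj hr _).2 ⟨V, hV, rfl⟩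
    exact ⟨this.1, this.2, hj⟩

variable [Fintype F]

theorem IsSunflower.supportWeight_subcodeOf (hS : IsSunflower u₀ u U₀ U)
    (hG : IsComplementMatrix U G) (V : Submodule F (Fin k → F)) :
    ((Fintype.card F : ℤ) - 1) * supportWeight (subcodeOf G V) =
      (Fintype.card F : ℤ) ^ k - (Fintype.card F : ℤ) ^ u 0 - (Fintype.card F : ℤ) ^ u 1 +
        (Fintype.card F : ℤ) ^ u₀ - (Fintype.card F : ℤ) ^ finrank F V +
        ((Fintype.card F : ℤ) ^ finrank F ↥(V ⊓ U 0) +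
          (Fintype.card F : ℤ) ^ finrank F ↥(V ⊓ U 1) -
          (Fintype.card F : ℤ) ^ finrank F ↥(V ⊓ U₀)) := by
  have := hS.supportWeight_eq le_rfl hG (dotOrthogonal V)
  rw [dotOrthogonal_dotOrthogonal] at this
  rw [subcodeOf, this, Fin.sum_univ_two, Fin.sum_univ_two]
  ring

theorem IsSunflower.subcodeCount_eq (hS : IsSunflower u₀ u U₀ U) (hG : IsComplementMatrix U G)
    (hinj : Function.Injective G.vecMulLinear) {r : ℕ} (hr : r ≤ k) (j : ℕ) :
    (subcodeCount (rowCode G) r j : ℚ) =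
      ∑ v ∈ sswdSet (Fintype.card F) k u₀ (u 0) (u 1) r j,
        countSubspaces (Fintype.card F) k u₀ (u 0) (u 1) (k - r) v.1 v.2.1 v.2.2 := by
  have hq : (2 : ℚ) ≤ Fintype.card F := by exact_mod_cast Fintype.one_lt_card (α := F)
  have hq1 : (Fintype.card F : ℚ) - 1 ≠ 0 := by linarith
  have hweight : ∀ V : Submodule F (Fin k → F), finrank F V = k - r →
      (supportWeight (subcodeOf G V) = j ↔
        ((Fintype.card F : ℚ) ^ finrank F ↥(V ⊓ U 0) - 1) / (Fintype.card F - 1) +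
          ((Fintype.card F : ℚ) ^ finrank F ↥(V ⊓ U 1) - 1) / (Fintype.card F - 1) -
          ((Fintype.card F : ℚ) ^ finrank F ↥(V ⊓ U₀) - 1) / (Fintype.card F - 1) =
        j - ((Fintype.card F : ℚ) ^ k - (Fintype.card F : ℚ) ^ u 0 -
          (Fintype.card F : ℚ) ^ u 1 + (Fintype.card F : ℚ) ^ u₀ -
          (Fintype.card F : ℚ) ^ (k - r) + 1) / (Fintype.card F - 1)) := by
    intro V hV
    have h := hS.supportWeight_subcodeOf hG V
    rw [hV] at h
    have h' : ((Fintype.card F : ℚ) - 1) * supportWeight (subcodeOf G V) =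
        (Fintype.card F : ℚ) ^ k - (Fintype.card F : ℚ) ^ u 0 - (Fintype.card F : ℚ) ^ u 1 +
        (Fintype.card F : ℚ) ^ u₀ - (Fintype.card F : ℚ) ^ (k - r) +
        ((Fintype.card F : ℚ) ^ finrank F ↥(V ⊓ U 0) +
          (Fintype.card F : ℚ) ^ finrank F ↥(V ⊓ U 1) -
          (Fintype.card F : ℚ) ^ finrank F ↥(V ⊓ U₀)) := by exact_mod_cast h
    rw [← Nat.cast_inj (R := ℚ), ← mul_right_inj' hq1, h']
    field_simp
    constructor <;> intro h <;> linarith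
  rw [subcodeCount_rowCode hinj hr, ncard_eq_sum_ncard_fiber
    (sswdSet (Fintype.card F) k u₀ (u 0) (u 1) r j)
    (fun V => (finrank F ↥(V ⊓ U₀), finrank F ↥(V ⊓ U 0), finrank F ↥(V ⊓ U 1))), Nat.cast_sum]
  · refine Finset.sum_congr rfl ?_
    rintro ⟨v₀, v₁, v₂⟩ hv
    simp only [sswdSet, Finset.mem_filter] at hv
    obtain ⟨-, heq, h01, h02, -⟩ := hv
    have := ncard_eq_countSubspaces hS.inf_eq (l := k - r) h01 h02
    rw [finrank_fin_fun, hS.1, hS.2.1, hS.2.1] at this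
    rw [← this]
    congr 2
    ext V
    simp only [Set.mem_ofPred_eq, Prod.mk.injEq]
    constructor
    · rintro ⟨⟨hV, -⟩, h0, h1, h2⟩
      exact ⟨hV, h0, h1, h2⟩
    · rintro ⟨hV, rfl, rfl, rfl⟩
      exact ⟨⟨hV, (hweight V hV).2 heq⟩, rfl, rfl, rfl⟩
  · rintro V ⟨hV, hj⟩
    -- The constraints in `sswdSet` other than the weight equation hold for every `V` of dimension
    -- `k - r`, so no subspace escapes the sum.
    have hb := hS.finrank_bounds V
    simp only [sswdSet, Finset.mem_filter, Finset.mem_product, Finset.mem_Icc, le_min_iff]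
    refine ⟨?_, (hweight V hV).1 hj, ?_⟩ <;> omega

/-- For fixed `r` the support weight is an increasing affine function of `q^v₁ + q^v₂ - q^v₀`, so
minimizing one minimizes the other. -/
theorem IsSunflower.genHammingWeight_eq (hS : IsSunflower u₀ u U₀ U) (hG : IsComplementMatrix U G)
    (hinj : Function.Injective G.vecMulLinear) {r : ℕ} (hr : r ≤ k) {M : ℤ}
    (hex : ∃ V : Submodule F (Fin k → F), finrank F V = k - r ∧
      (Fintype.card F : ℤ) ^ finrank F ↥(V ⊓ U 0) + (Fintype.card F : ℤ) ^ finrank F ↥(V ⊓ U 1) -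
        (Fintype.card F : ℤ) ^ finrank F ↥(V ⊓ U₀) = M)
    (hmin : ∀ V : Submodule F (Fin k → F), finrank F V = k - r →
      M ≤ (Fintype.card F : ℤ) ^ finrank F ↥(V ⊓ U 0) +
        (Fintype.card F : ℤ) ^ finrank F ↥(V ⊓ U 1) -
        (Fintype.card F : ℤ) ^ finrank F ↥(V ⊓ U₀)) :
    (genHammingWeight (rowCode G) r : ℚ) =
      ((Fintype.card F : ℚ) ^ k - (Fintype.card F : ℚ) ^ u 0 - (Fintype.card F : ℚ) ^ u 1 +
        (Fintype.card F : ℚ) ^ u₀ - (Fintype.card F : ℚ) ^ (k - r) + M) /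
        (Fintype.card F - 1) := by
  have hq : (2 : ℤ) ≤ Fintype.card F := by exact_mod_cast Fintype.one_lt_card (α := F)
  have hq' : (2 : ℚ) ≤ Fintype.card F := by exact_mod_cast hq
  obtain ⟨V, hV, hM⟩ := hex
  have hVw := hS.supportWeight_subcodeOf hG V
  have hleast : IsLeast {w : ℕ | ∃ D : Submodule F (Fin n → F), D ≤ rowCode G ∧
      finrank F D = r ∧ supportWeight D = w} (supportWeight (subcodeOf G V)) := by
    constructor
    · obtain ⟨h1, h2⟩ := (exists_subcodeOf_iff hinj hr _).2 ⟨V, hV, rfl⟩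
      exact ⟨_, h1, h2, rfl⟩
    · rintro w ⟨D, hD, hDr, rfl⟩
      obtain ⟨W, hW, rfl⟩ := (exists_subcodeOf_iff hinj hr D).1 ⟨hD, hDr⟩
      have hWw := hS.supportWeight_subcodeOf hG W
      have h1 := hmin W hW
      rw [hV, hM] at hVw
      rw [hW] at hWw
      have : ((Fintype.card F : ℤ) - 1) * supportWeight (subcodeOf G V) ≤
          ((Fintype.card F : ℤ) - 1) * supportWeight (subcodeOf G W) := by
        rw [hVw, hWw]
        linarith
      exact_mod_cast le_of_mul_le_mul_left this (by linarith)
  rw [genHammingWeight, hleast.csInf_eq, eq_div_iff (by linarith), mul_comm]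
  rw [hV, hM] at hVw
  exact_mod_cast hVw

theorem IsSunflower.exists_finrank_eq (hS : IsSunflower u₀ u U₀ U) {l v₀ v₁ v₂ : ℕ} (t : ℕ)
    (h01 : v₀ ≤ v₁) (h02 : v₀ ≤ v₂)
    (hs : t + v₁ + v₂ ≤ l + v₀) (hl : l + v₀ - (t + v₁ + v₂) ≤ k + u₀ - (u 0 + u 1))
    (h₀ : v₀ ≤ u₀) (h₁ : t + (v₁ - v₀) ≤ u 0 - u₀) (h₂ : t + (v₂ - v₀) ≤ u 1 - u₀)
    (ht₁ : t + v₁ ≤ u 0) (ht₂ : t + v₂ ≤ u 1) :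
    ∃ V : Submodule F (Fin k → F), finrank F V = l ∧ finrank F ↥(V ⊓ U₀) = v₀ ∧
      finrank F ↥(V ⊓ U 0) = v₁ ∧ finrank F ↥(V ⊓ U 1) = v₂ := by
  have hpos := countSubspaces_pos (q := Fintype.card F) Fintype.one_lt_card t hs hl h₀ h₁ h₂
    ht₁ ht₂
  have := ncard_eq_countSubspaces hS.inf_eq (l := l) h01 h02
  rw [finrank_fin_fun, hS.1, hS.2.1, hS.2.1] at this
  rw [← this, Nat.cast_pos, Set.ncard_pos] at hpos
  exact hpos

theorem IsSunflower.genHammingWeight_of_le (hS : IsSunflower u₀ u U₀ U)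
    (hG : IsComplementMatrix U G) (hinj : Function.Injective G.vecMulLinear)
    (hk : u 0 + u 1 ≤ k + u₀) (hlt : ∀ i, u₀ < u i) (h12 : u 0 ≤ u 1) {r : ℕ}
    (hr : r ≤ u 0 - u₀) :
    (genHammingWeight (rowCode G) r : ℚ) =
      ((Fintype.card F : ℚ) ^ k - (Fintype.card F : ℚ) ^ (k - r)
        - ((Fintype.card F : ℚ) ^ u 0 - (Fintype.card F : ℚ) ^ (u 0 - r))
        - ((Fintype.card F : ℚ) ^ u 1 - (Fintype.card F : ℚ) ^ (u 1 - r))) /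
        (Fintype.card F - 1) := by
  have hq : (1 : ℤ) ≤ Fintype.card F := by exact_mod_cast Fintype.card_pos (α := F)
  have hl0 := hlt 0
  have hl1 := hlt 1
  rw [hS.genHammingWeight_eq hG hinj (by omega) (M := (Fintype.card F : ℤ) ^ (u 0 - r) +
    (Fintype.card F : ℤ) ^ (u 1 - r) - (Fintype.card F : ℤ) ^ u₀)]
  · push_cast
    ring
  -- All three extremes are compatible: `V` contains the core and meets each petal in the least
  -- possible dimension. With `t = r`, the Gaussian coefficient for extending beyond `U 0 ⊔ U 1` has
  -- equal arguments.
  · obtain ⟨V, hV, h0, h1, h2⟩ := hS.exists_finrank_eq (l := k - r) (v₀ := u₀) (v₁ := u 0 - r)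
      (v₂ := u 1 - r) r (by omega) (by omega) (by omega) (by omega) (by omega) (by omega)
      (by omega) (by omega) (by omega)
    exact ⟨V, hV, by rw [h0, h1, h2]⟩
  · intro V hV
    have hb := hS.finrank_bounds V
    have e0 := pow_le_pow_right₀ hq (show finrank F ↥(V ⊓ U₀) ≤ u₀ by omega)
    have e1 := pow_le_pow_right₀ hq (show u 0 - r ≤ finrank F ↥(V ⊓ U 0) by omega)
    have e2 := pow_le_pow_right₀ hq (show u 1 - r ≤ finrank F ↥(V ⊓ U 1) by omega)
    linarith

theorem IsSunflower.genHammingWeight_of_le_of_le (hS : IsSunflower u₀ u U₀ U)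
    (hG : IsComplementMatrix U G) (hinj : Function.Injective G.vecMulLinear)
    (hk : u 0 + u 1 ≤ k + u₀) (hlt : ∀ i, u₀ < u i) (h12 : u 0 ≤ u 1) {r : ℕ}
    (hr : u 0 - u₀ ≤ r) (hr' : r ≤ u 1) :
    (genHammingWeight (rowCode G) r : ℚ) =
      ((Fintype.card F : ℚ) ^ k - (Fintype.card F : ℚ) ^ (k - r) - (Fintype.card F : ℚ) ^ u 0
        - ((Fintype.card F : ℚ) ^ u 1 - (Fintype.card F : ℚ) ^ (u 1 - r))
        + (Fintype.card F : ℚ) ^ u₀) / (Fintype.card F - 1) := by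
  have hq : (1 : ℤ) ≤ Fintype.card F := by exact_mod_cast Fintype.card_pos (α := F)
  have hl0 := hlt 0
  have hl1 := hlt 1
  rw [hS.genHammingWeight_eq hG hinj (by omega) (M := (Fintype.card F : ℤ) ^ (u 1 - r))]
  · push_cast
    ring
  -- The bound uses only `v₀ ≤ v₁` and `u 1 - r ≤ v₂`, so equality needs `v₁ = v₀` and `v₂ = u 1 -
  -- r`. Taking `v₀` as large as the core and `v₂` allow makes `t = u 0 - u₀` admissible.
  · obtain ⟨V, hV, h0, h1, h2⟩ := hS.exists_finrank_eq (l := k - r) (v₀ := min u₀ (u 1 - r))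
      (v₁ := min u₀ (u 1 - r)) (v₂ := u 1 - r) (u 0 - u₀) (by omega) (by omega) (by omega)
      (by omega) (by omega) (by omega) (by omega) (by omega) (by omega)
    exact ⟨V, hV, by rw [h0, h1, h2]; ring⟩
  · intro V hV
    have hb := hS.finrank_bounds V
    have e1 := pow_le_pow_right₀ hq (show finrank F ↥(V ⊓ U₀) ≤ finrank F ↥(V ⊓ U 0) by omega)
    have e2 := pow_le_pow_right₀ hq (show u 1 - r ≤ finrank F ↥(V ⊓ U 1) by omega)
    linarith

theorem IsSunflower.genHammingWeight_of_ge (hS : IsSunflower u₀ u U₀ U)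
    (hG : IsComplementMatrix U G) (hinj : Function.Injective G.vecMulLinear)
    (hk : u 0 + u 1 ≤ k + u₀) (hlt : ∀ i, u₀ < u i) (h12 : u 0 ≤ u 1) {r : ℕ}
    (hr : u 1 ≤ r) (hr' : r ≤ k) :
    (genHammingWeight (rowCode G) r : ℚ) =
      ((Fintype.card F : ℚ) ^ k - (Fintype.card F : ℚ) ^ (k - r) - (Fintype.card F : ℚ) ^ u 0
        - (Fintype.card F : ℚ) ^ u 1 + (Fintype.card F : ℚ) ^ u₀ + 1) /
        (Fintype.card F - 1) := by
  have hq : (1 : ℤ) ≤ Fintype.card F := by exact_mod_cast Fintype.card_pos (α := F)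
  have hl0 := hlt 0
  have hl1 := hlt 1
  rw [hS.genHammingWeight_eq hG hinj hr' (M := 1)]
  · push_cast
    ring
  -- `V` avoids both petals. Its trace on `U 0 ⊔ U 1` has the least possible dimension `t`,
  -- truncated to zero once `r` exceeds the dimension of that sum.
  · obtain ⟨V, hV, h0, h1, h2⟩ := hS.exists_finrank_eq (l := k - r) (v₀ := 0)
      (v₁ := 0) (v₂ := 0) (u 0 + u 1 - u₀ - r) (by omega) (by omega) (by omega)
      (by omega) (by omega) (by omega) (by omega) (by omega) (by omega)
    exact ⟨V, hV, by rw [h0, h1, h2]; ring⟩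
  · intro V hV
    have hb := hS.finrank_bounds V
    have e1 := pow_le_pow_right₀ hq (show finrank F ↥(V ⊓ U₀) ≤ finrank F ↥(V ⊓ U 0) by omega)
    have e2 := one_le_pow₀ (n := finrank F ↥(V ⊓ U 1)) hq
    linarith

end TwoPetals

/-! ### The main theorem. -/

theorem theorem3p4 {F : Type*} [Field F] [Fintype F] [DecidableEq F] (q k h u₀ : ℕ)
    (u : Fin h → ℕ) (hq : Fintype.card F = q) (hu₀ : 1 ≤ u₀) (hh : 2 ≤ h) (hhq : h ≤ q)
    (hlt : ∀ i, u₀ < u i) (hmono : Monotone u)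
    (hk : ∑ i, u i ≤ k + (h - 1) * u₀)
    (hsize : (q : ℤ) ^ u₀ - 1 + ∑ i, ((q : ℤ) ^ u i - (q : ℤ) ^ u₀) <
      (q : ℤ) ^ k - (q : ℤ) ^ (k - 1))
    (hdefect : ((h : ℚ) - 1) * (((q : ℚ) ^ u₀ - 1) / (q - 1)) < u ⟨0, by omega⟩) :
    -- the construction is possible, with subspaces that are independent modulo `U₀`
    (∃ (U₀ : Submodule F (Fin k → F)) (U : Fin h → Submodule F (Fin k → F)) (n : ℕ)
        (G : Matrix (Fin k) (Fin n) F),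
      IsSunflower u₀ u U₀ U ∧ finrank F ↥(⨆ i, U i) + (h - 1) * u₀ = ∑ i, u i ∧
        IsComplementMatrix U G) ∧
    ∀ (U₀ : Submodule F (Fin k → F)) (U : Fin h → Submodule F (Fin k → F)) (n : ℕ)
        (G : Matrix (Fin k) (Fin n) F), IsSunflower u₀ u U₀ U → IsComplementMatrix U G →
      -- parameters and optimality
      (n : ℚ) = ((q : ℚ) ^ k - q ^ u₀ - ∑ i, ((q : ℚ) ^ u i - (q : ℚ) ^ u₀)) / (q - 1) ∧
      (∃ d : ℕ, (d : ℤ) = (q : ℤ) ^ (k - 1) - ∑ i, (q : ℤ) ^ (u i - 1) ∧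
        IsOptimalCode (rowCode G) k d) ∧
      -- (a) weight distribution
      (finrank F ↥(⨆ i, U i) + (h - 1) * u₀ = ∑ i, u i →
        ∀ w : ℕ, (weightCount (rowCode G) w : ℤ) =
          (if w = 0 then 1 else 0)
          + (if (w : ℤ) = (q : ℤ) ^ (k - 1) + ((h : ℤ) - 1) * (q : ℤ) ^ (u₀ - 1)
                - ∑ i, (q : ℤ) ^ (u i - 1)
              then ((q : ℤ) ^ u₀ - 1) * (q : ℤ) ^ (k - u₀) else 0)
          + (∑ S : Finset (Fin h),
              if S.Nonempty ∧ (w : ℤ) = (q : ℤ) ^ (k - 1) - ∑ i ∈ S, (q : ℤ) ^ (u i - 1)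
              then (∏ i ∈ S, ((q : ℤ) ^ (u i - u₀) - 1)) *
                (q : ℤ) ^ (k + (h - 1) * u₀ - ∑ i, u i) else 0)
          + (if (w : ℤ) = (q : ℤ) ^ (k - 1)
              then (q : ℤ) ^ (k + (h - 1) * u₀ - ∑ i, u i) - 1 else 0)) ∧
      ∀ h2 : h = 2,
        ∀ (u₁ u₂ : ℕ) (U₁ U₂ : Submodule F (Fin k → F)),
        u₁ = u ⟨0, by omega⟩ → u₂ = u ⟨1, by omega⟩ → U₁ = U ⟨0, by omega⟩ →
        U₂ = U ⟨1, by omega⟩ →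
        -- (b) generalized Hamming weights
        (∀ r : ℕ, 1 ≤ r → r ≤ u₁ - u₀ →
          (genHammingWeight (rowCode G) r : ℚ) =
            ((q : ℚ) ^ k - q ^ (k - r) - (q ^ u₁ - q ^ (u₁ - r)) - (q ^ u₂ - q ^ (u₂ - r)))
              / (q - 1)) ∧
        (∀ r : ℕ, u₁ - u₀ ≤ r → r ≤ u₂ →
          (genHammingWeight (rowCode G) r : ℚ) =
            ((q : ℚ) ^ k - q ^ (k - r) - q ^ u₁ - (q ^ u₂ - q ^ (u₂ - r)) + q ^ u₀)
              / (q - 1)) ∧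
        (∀ r : ℕ, u₂ ≤ r → r < k →
          (genHammingWeight (rowCode G) r : ℚ) =
            ((q : ℚ) ^ k - q ^ (k - r) - q ^ u₁ - q ^ u₂ + q ^ u₀ + 1) / (q - 1)) ∧
        -- (c) subcode support weight distribution, with the subspace counts evaluated
        (∀ r : ℕ, 1 ≤ r → r ≤ k → ∀ j : ℕ,
          (subcodeCount (rowCode G) r j : ℚ) =
            ∑ v ∈ sswdSet q k u₀ u₁ u₂ r j,
              countSubspaces q k u₀ u₁ u₂ (k - r) v.1 v.2.1 v.2.2) ∧
        (∀ l v₀ v₁ v₂ : ℕ, v₀ ≤ v₁ → v₀ ≤ v₂ →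
          (({V : Submodule F (Fin k → F) | finrank F V = l ∧ finrank F ↥(V ⊓ U₀) = v₀ ∧
              finrank F ↥(V ⊓ U₁) = v₁ ∧ finrank F ↥(V ⊓ U₂) = v₂}.ncard : ℕ) : ℚ) =
            countSubspaces q k u₀ u₁ u₂ l v₀ v₁ v₂) := by
  subst hq
  have hq2 : 2 ≤ Fintype.card F := Fintype.one_lt_card
  have hqQ : (2 : ℚ) ≤ Fintype.card F := by exact_mod_cast hq2
  have hu₀k := add_le_of_sum_le hlt (by omega) hk
  have hsum := sum_pow_pred_lt hq2 (fun i => hu₀.trans (hlt i).le) (by omega)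
    (sum_pow_lt hhq hu₀k hh hsize)
  obtain ⟨d, hd⟩ := Int.eq_ofNat_of_zero_le (sub_nonneg.2 hsum.le)
  refine ⟨?_, ?_⟩
  · obtain ⟨U₀, U, hS, hdim⟩ := exists_isSunflower (F := F) hh hlt hk
    obtain ⟨n, G, hG⟩ := exists_isComplementMatrix U
    exact ⟨U₀, U, n, G, hS, hdim, hG⟩
  intro U₀ U n G hS hG
  -- Every nonzero `a` gives a word of positive weight, since the weight bound is positive by
  -- `hsum`; injectivity is what identifies subcodes with spaces of coefficient vectors.
  have hinj : Function.Injective G.vecMulLinear := vecMulLinear_injective_of_pos fun a ha => by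
    have := hS.le_hammingNorm hh hu₀ hlt hG ha
    have : (0 : ℤ) < hammingNorm (G.vecMulLinear a) := (sub_pos.2 hsum).trans_le this
    exact_mod_cast this
  refine ⟨?_, ⟨d, hd.symm, hS.isLinearCode hh hhq hu₀ hlt hu₀k hG hinj hd.symm,
    hS.not_isLinearCode hh hhq hlt hG (m := u ⟨0, by omega⟩)
      (fun i => hmono (Nat.zero_le _)) (hu₀.trans (hlt _).le) ?_ hd.symm⟩,
    fun hdim w => hS.weightCount_eq hh hu₀ hlt hG hinj hdim w, ?_⟩
  · rw [eq_div_iff (by linarith), mul_comm]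
    exact_mod_cast hS.length hh hG
  · rw [← mul_div_assoc, div_lt_iff₀ (by linarith), mul_comm (u _ : ℚ)] at hdefect
    exact_mod_cast hdefect
  rintro rfl u₁ u₂ U₁ U₂ rfl rfl rfl rfl
  rw [Fin.sum_univ_two, show 2 - 1 = 1 from rfl, one_mul] at hk
  have h12 : u 0 ≤ u 1 := hmono (Fin.zero_le _)
  refine ⟨fun r _ hr => hS.genHammingWeight_of_le hG hinj hk hlt h12 hr,
    fun r hr hr' => hS.genHammingWeight_of_le_of_le hG hinj hk hlt h12 hr hr',
    fun r hr hr' => hS.genHammingWeight_of_ge hG hinj hk hlt h12 hr hr'.le,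
    fun r _ hr j => hS.subcodeCount_eq hG hinj hr j, fun l v₀ v₁ v₂ h01 h02 => ?_⟩
  have := ncard_eq_countSubspaces hS.inf_eq (l := l) h01 h02
  rw [finrank_fin_fun, hS.1, hS.2.1, hS.2.1] at this
  exact this
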